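/- A *C\*-algebraic spectral set* $\Sigma$ assigns to every element $E$ of every unital complex C\*-algebra $\mathscr E$ a closed set $\Sigma(E\mid\mathscr E)\subset\mathbb C$, such that $\Sigma(\pi(E)\mid\mathscr F)\subset\Sigma(E\mid\mathscr E)$ for every unital $^*$-morphism $\pi:\mathscr E\to\mathscr F$ and every $E\in\mathscr E$, with equality if $\pi$ is injective. For a bounded operator $H$ on a Hilbert space $\mathcal H$ write $\Sigma(H):=\Sigma(H\mid\mathbb B(\mathcal H))$. Let $\Xi$ be a Hausdorff, locally compact, $\sigma$-compact topological groupoid with unit space $X$, source and range maps $\mathrm d,\mathrm r:\Xi\to X$ and fibres $\Xi_x=\mathrm d^{-1}(\{x\})$. Let $\{\lambda_x\}_{x\in X}$ be a right Haar system: $\lambda_x$ is a Radon measure on $\Xi_x$ with full support, $x\mapsto\int_{\Xi_x}f\,d\lambda_x$ is continuous for every $f\in C_c(\Xi)$, and for each $\xi\in\Xi$ the map $\eta\mapsto\eta\xi$ transports $\lambda_{\mathrm r(\xi)}$ to $\lambda_{\mathrm d(\xi)}$. Let $\omega$ be a continuous normalized $2$-cocycle on $\Xi$ with values in the unit circle.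 For $f\in C_c(\Xi)$ and $x\in X$ let $\Pi_x(f)$ be the bounded operator on $\mathcal H_x:=L^2(\Xi_x;\lambda_x)$ given by $$(\Pi_x(f)u)(\xi)=\int_{\Xi_x}f(\xi\eta^{-1})\,u(\eta)\,\omega(\xi\eta^{-1},\eta)\,d\lambda_x(\eta).$$ Let $C^*_r(\Xi,\omega)$ be the reduced twisted groupoid C\*-algebra, i.e. the completion of the twisted convolution algebra $C_c(\Xi,\omega)$ in the norm $\|f\|=\sup_{x\in X}\|\Pi_x(f)\|$. Each $\Pi_x$ extends to $C^*_r(\Xi,\omega)$, and then to a representation $\Pi_x^{\mathbf M}$ of its multiplier algebra, determined by $\Pi_x^{\mathbf M}(F)\,\Pi_x(a)=\Pi_x(Fa)$ for $a\in C^*_r(\Xi,\omega)$. Fix a multiplier $F$ of $C^*_r(\Xi,\omega)$ and put $H_x:=\Pi_x^{\mathbf M}(F)\in\mathbb B(\mathcal H_x)$ for $x\in X$. Let $\mathcal Q_x$ be the closure in $X$ of the orbit $\mathcal O_x=\mathrm r(\Xi_x)$. **Theorem.** Let $x,y\in X$. (i) If $\mathcal Q_x\subset\mathcal Q_y$, then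 $\Sigma(H_x)\subset\Sigma(H_y)$ for every C\*-algebraic spectral set $\Sigma$. (ii) If $\mathcal Q_x=\mathcal Q_y$, then $\Sigma(H_x)=\Sigma(H_y)$ for every C\*-algebraic spectral set $\Sigma$. In particular $H_x$ and $H_y$ have the same spectrum, the same $\epsilon$-pseudospectra $\{\lambda\in\mathbb C:\|(H-\lambda)^{-1}\|\ge1/\epsilon\}$ for all $\epsilon>0$ (with the norm taken to be $\infty$ if $H-\lambda$ is not invertible), the same numerical range $\{\phi(H):\phi\text{ a state of }\mathbb B(\mathcal H)\}$, and, for every complex polynomial $p$, the same polynomial hull $\{\lambda\in\mathbb C:|p(\lambda)|\le\|p(H)\|\}$. -/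

import Mathlib

open MeasureTheory Filter Topology
open scoped ENNReal NNReal MultiplierAlgebra ComplexOrder

universe u v

theorem stronglyMeasurable_of_continuous_prod {Y : Type*} [TopologicalSpace Y] [T2Space Y]
    [LocallyCompactSpace Y] [SigmaCompactSpace Y] [MeasurableSpace Y] [BorelSpace Y]
    {K : Y × Y → ℂ} (hK : Continuous K) : StronglyMeasurable K := by
  obtain ⟨e⟩ : Nonempty (CompactExhaustion (Y × Y)) := inferInstance
  have h : ∀ n, ∃ χ : C(Y × Y, ℝ), Set.EqOn χ 1 (e n) ∧ HasCompactSupport χ := fun n => by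
    obtain ⟨χ, h1, -, h3, -⟩ := exists_continuous_one_zero_of_isCompact (e.isCompact n)
      isClosed_empty (Set.disjoint_empty _)
    exact ⟨χ, h1, h3⟩
  choose χ h1 h2 using h
  refine stronglyMeasurable_of_tendsto (f := fun n p => (χ n p : ℂ) * K p) atTop
    (fun n => ?_) (tendsto_pi_nhds.2 fun p => ?_)
  · refine HasCompactSupport.stronglyMeasurable_of_prod
      ((Complex.continuous_ofReal.comp (χ n).continuous).mul hK) ?_
    exact ((h2 n).comp_left (g := ((↑) : ℝ → ℂ)) Complex.ofReal_zero).mul_right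
  · obtain ⟨n, hn⟩ := e.exists_mem p
    refine tendsto_const_nhds.congr' ?_
    filter_upwards [eventually_ge_atTop n] with m hm
    rw [h1 m (e.subset hm hn)]
    simp

theorem schur_lintegral {Y : Type*} [MeasurableSpace Y] {ν : Measure Y} [SFinite ν]
    {K : Y × Y → ℂ} (hK : StronglyMeasurable K) {C : ℝ≥0}
    (h₁ : ∀ ξ, ∫⁻ η, ‖K (ξ, η)‖ₑ ∂ν ≤ C) (h₂ : ∀ η, ∫⁻ ξ, ‖K (ξ, η)‖ₑ ∂ν ≤ C)
    {u : Y → ℂ} (hu : AEStronglyMeasurable u ν) :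
    ∫⁻ ξ, (∫⁻ η, ‖K (ξ, η)‖ₑ * ‖u η‖ₑ ∂ν) ^ (2 : ℝ) ∂ν ≤
      (C : ℝ≥0∞) ^ (2 : ℝ) * ∫⁻ η, ‖u η‖ₑ ^ (2 : ℝ) ∂ν := by
  have hKm : Measurable fun p : Y × Y => ‖K p‖ₑ := hK.measurable.enorm
  have step : ∀ ξ, (∫⁻ η, ‖K (ξ, η)‖ₑ * ‖u η‖ₑ ∂ν) ^ (2 : ℝ) ≤
      C * ∫⁻ η, ‖K (ξ, η)‖ₑ * ‖u η‖ₑ ^ (2 : ℝ) ∂ν := fun ξ => by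
    have hk : Measurable fun η => ‖K (ξ, η)‖ₑ := hKm.comp measurable_prodMk_left
    have e : ∀ η, ‖K (ξ, η)‖ₑ * ‖u η‖ₑ =
        (‖K (ξ, η)‖ₑ ^ (1 / 2 : ℝ)) * (‖K (ξ, η)‖ₑ ^ (1 / 2 : ℝ) * ‖u η‖ₑ) := fun η => by
      rw [← mul_assoc, ← ENNReal.rpow_add_of_nonneg _ _ (by norm_num) (by norm_num),
        add_halves, ENNReal.rpow_one]
    have hol := ENNReal.lintegral_mul_le_Lp_mul_Lq ν Real.HolderConjugate.two_two
      (f := fun η => ‖K (ξ, η)‖ₑ ^ (1 / 2 : ℝ))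
      (g := fun η => ‖K (ξ, η)‖ₑ ^ (1 / 2 : ℝ) * ‖u η‖ₑ)
      (hk.pow_const _).aemeasurable ((hk.pow_const _).aemeasurable.mul hu.enorm)
    have e2 : ∀ a : ℝ≥0∞, (a ^ (1 / 2 : ℝ)) ^ (2 : ℝ) = a := fun a => by
      rw [← ENNReal.rpow_mul]; norm_num
    have e3 : ∀ a b : ℝ≥0∞, (a ^ (1 / 2 : ℝ) * b) ^ (2 : ℝ) = a * b ^ (2 : ℝ) := fun a b => by
      rw [ENNReal.mul_rpow_of_nonneg _ _ zero_le_two, e2]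
    simp only [Pi.mul_apply, e2, e3, ← e] at hol
    calc _ ≤ _ := ENNReal.rpow_le_rpow hol zero_le_two
      _ = (∫⁻ η, ‖K (ξ, η)‖ₑ ∂ν) * ∫⁻ η, ‖K (ξ, η)‖ₑ * ‖u η‖ₑ ^ (2 : ℝ) ∂ν := by
        rw [ENNReal.mul_rpow_of_nonneg _ _ zero_le_two, e2, e2]
      _ ≤ _ := by gcongr; exact h₁ ξ
  have hm : AEMeasurable (Function.uncurry fun ξ η => ‖K (ξ, η)‖ₑ * ‖u η‖ₑ ^ (2 : ℝ))
      (ν.prod ν) :=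
    hKm.aemeasurable.mul ((hu.enorm.pow_const 2).comp_quasiMeasurePreserving
      Measure.quasiMeasurePreserving_snd)
  calc _ ≤ ∫⁻ ξ, C * ∫⁻ η, ‖K (ξ, η)‖ₑ * ‖u η‖ₑ ^ (2 : ℝ) ∂ν ∂ν := lintegral_mono step
    _ = C * ∫⁻ ξ, ∫⁻ η, ‖K (ξ, η)‖ₑ * ‖u η‖ₑ ^ (2 : ℝ) ∂ν ∂ν :=
        lintegral_const_mul' _ _ ENNReal.coe_ne_top
    _ = C * ∫⁻ η, (∫⁻ ξ, ‖K (ξ, η)‖ₑ ∂ν) * ‖u η‖ₑ ^ (2 : ℝ) ∂ν := by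
        rw [lintegral_lintegral_swap hm]
        congr 1
        refine lintegral_congr fun η => ?_
        exact lintegral_mul_const _ (hKm.comp measurable_prodMk_right)
    _ ≤ C * ∫⁻ η, C * ‖u η‖ₑ ^ (2 : ℝ) ∂ν := by
        gcongr with η; exact h₂ η
    _ = _ := by
        rw [lintegral_const_mul' _ _ ENNReal.coe_ne_top, ← mul_assoc, ENNReal.rpow_two, sq]

/-- Schur's test: an integral kernel with uniformly bounded row and column integrals defines a
bounded operator on `L²`. -/
theorem schur_test {Y : Type*} [MeasurableSpace Y] {ν : Measure Y} [SFinite ν]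
    {K : Y × Y → ℂ} (hK : StronglyMeasurable K) {C : ℝ≥0}
    (h₁ : ∀ ξ, ∫⁻ η, ‖K (ξ, η)‖ₑ ∂ν ≤ C) (h₂ : ∀ η, ∫⁻ ξ, ‖K (ξ, η)‖ₑ ∂ν ≤ C) :
    ∃ T : Lp ℂ 2 ν →L[ℂ] Lp ℂ 2 ν, ‖T‖ ≤ C ∧
      ∀ u, T u =ᵐ[ν] fun ξ => ∫ η, K (ξ, η) * u η ∂ν := by
  have hmeas : ∀ u : Lp ℂ 2 ν, AEStronglyMeasurable (fun ξ => ∫ η, K (ξ, η) * u η ∂ν) ν := by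
    intro u
    refine AEStronglyMeasurable.integral_prod_right' (f := fun p : Y × Y => K p * u p.2) ?_
    exact hK.aestronglyMeasurable.mul (Lp.aestronglyMeasurable u).comp_snd
  have hnorm : ∀ u : Lp ℂ 2 ν, ∫⁻ η, ‖u η‖ₑ ^ (2 : ℝ) ∂ν = ‖u‖ₑ ^ (2 : ℝ) := by
    intro u
    rw [Lp.enorm_def, eLpNorm_eq_lintegral_rpow_enorm_toReal two_ne_zero ENNReal.ofNat_ne_top,
      ← ENNReal.rpow_mul]
    simp
  have hb : ∀ u : Lp ℂ 2 ν, eLpNorm (fun ξ => ∫ η, K (ξ, η) * u η ∂ν) 2 ν ≤ C * ‖u‖ₑ := by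
    intro u
    rw [eLpNorm_eq_lintegral_rpow_enorm_toReal two_ne_zero ENNReal.ofNat_ne_top]
    have : ∫⁻ ξ, ‖∫ η, K (ξ, η) * u η ∂ν‖ₑ ^ (2 : ℝ) ∂ν ≤ (C * ‖u‖ₑ) ^ (2 : ℝ) := by
      rw [ENNReal.mul_rpow_of_nonneg _ _ zero_le_two, ← hnorm]
      refine le_trans (lintegral_mono fun ξ => ?_)
        (schur_lintegral hK h₁ h₂ (Lp.aestronglyMeasurable u))
      refine ENNReal.rpow_le_rpow ((enorm_integral_le_lintegral_enorm _).trans ?_) zero_le_two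
      simp only [enorm_mul, le_refl]
    calc _ ≤ ((C * ‖u‖ₑ) ^ (2 : ℝ)) ^ (1 / 2 : ℝ) := by
          refine ENNReal.rpow_le_rpow ?_ (by norm_num)
          simpa using this
      _ = _ := by rw [← ENNReal.rpow_mul]; norm_num
  have hint : ∀ u : Lp ℂ 2 ν, ∀ᵐ ξ ∂ν, Integrable (fun η => K (ξ, η) * u η) ν := by
    intro u
    have hA := schur_lintegral hK h₁ h₂ (Lp.aestronglyMeasurable u)
    rw [hnorm] at hA
    have hfin : ∫⁻ ξ, (∫⁻ η, ‖K (ξ, η)‖ₑ * ‖u η‖ₑ ∂ν) ^ (2 : ℝ) ∂ν ≠ ∞ := by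
      refine ne_top_of_le_ne_top ?_ hA
      exact ENNReal.mul_ne_top (by simp) (by simp)
    have hAm : AEMeasurable (fun ξ => (∫⁻ η, ‖K (ξ, η)‖ₑ * ‖u η‖ₑ ∂ν) ^ (2 : ℝ)) ν := by
      refine AEMeasurable.pow_const ?_ _
      exact AEMeasurable.lintegral_prod_right' (f := fun p : Y × Y => ‖K p‖ₑ * ‖u p.2‖ₑ)
        (hK.measurable.enorm.aemeasurable.mul
          (Lp.aestronglyMeasurable u).comp_snd.enorm)
    filter_upwards [ae_lt_top' hAm hfin] with ξ hξ
    refine ⟨(hK.comp_measurable measurable_prodMk_left).aestronglyMeasurable.mul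
      (Lp.aestronglyMeasurable u), ?_⟩
    rw [hasFiniteIntegral_iff_enorm]
    simp only [enorm_mul]
    by_contra hcon
    rw [not_lt, top_le_iff] at hcon
    rw [hcon] at hξ
    simp at hξ
  have hmem : ∀ u : Lp ℂ 2 ν, MemLp (fun ξ => ∫ η, K (ξ, η) * u η ∂ν) 2 ν := fun u =>
    ⟨hmeas u, (hb u).trans_lt (ENNReal.mul_lt_top (by simp) (by simp))⟩
  refine ⟨LinearMap.mkContinuous
    { toFun := fun u => (hmem u).toLp _
      map_add' := fun u v => ?_
      map_smul' := fun c u => ?_ } C fun u => ?_, LinearMap.mkContinuous_norm_le _ C.2 _,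
      fun u => (hmem u).coeFn_toLp⟩
  · rw [← MemLp.toLp_add]
    refine MemLp.toLp_congr _ _ ?_
    filter_upwards [hint u, hint v] with ξ hu hv
    rw [Pi.add_apply, ← integral_add hu hv]
    refine integral_congr_ae ?_
    filter_upwards [Lp.coeFn_add u v] with η h
    rw [h, Pi.add_apply, mul_add]
  · rw [RingHom.id_apply, ← MemLp.toLp_const_smul]
    refine MemLp.toLp_congr _ _ (Eventually.of_forall fun ξ => ?_)
    simp only [Pi.smul_apply]
    rw [← integral_smul]
    refine integral_congr_ae ?_
    filter_upwards [Lp.coeFn_smul c u] with η h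
    rw [h, Pi.smul_apply, smul_eq_mul, smul_eq_mul]
    ring
  · simp only [LinearMap.coe_mk, AddHom.coe_mk, Lp.norm_toLp]
    refine ENNReal.toReal_le_of_le_ofReal (by positivity) ((hb u).trans_eq ?_)
    rw [ENNReal.ofReal_mul (by exact C.2), ofReal_norm]
    simp

section Mult
variable {A H : Type*} [NonUnitalCStarAlgebra A] [NormedAddCommGroup H] [InnerProductSpace ℂ H]
  [CompleteSpace H]

theorem multiplier_fst_mul (F : 𝓜(ℂ, A)) (a b : A) :
    F.fst (a * b) = F.fst a * b := by
  have h : ∀ x : A, x * (F.fst (a * b) - F.fst a * b) = 0 := fun x => by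
    rw [mul_sub, ← F.central, ← mul_assoc, ← mul_assoc, ← F.central, sub_self]
  rw [← sub_eq_zero, ← CStarRing.star_mul_self_eq_zero_iff]
  exact h _

theorem exists_multiplierExtension (π : A →⋆ₙₐ[ℂ] (H →L[ℂ] H)) (F : 𝓜(ℂ, A)) :
    ∃ T : H →L[ℂ] H, (∀ a v, T (π a v) = π (F.fst a) v) ∧ ∀ v, (∀ a, π a v = 0) → T v = 0 := by
  let _ : PartialOrder A := CStarAlgebra.spectralOrder A
  have _ : StarOrderedRing A := CStarAlgebra.spectralOrderedRing A
  have hl := CStarAlgebra.increasingApproximateUnit A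
  set l := CStarAlgebra.approximateUnit A with hl_def
  have _ : l.NeBot := hl.neBot
  have hπ : Continuous π := AddMonoidHomClass.continuous_of_bound π 1 fun a => by
    rw [one_mul]; exact NonUnitalStarAlgHom.norm_apply_le π a
  have hbd : ∀ᶠ e in l, ∀ v, ‖π (F.fst e) v‖ ≤ ‖F.fst‖ * ‖v‖ := by
    filter_upwards [hl.eventually_norm] with e he v
    refine (ContinuousLinearMap.le_opNorm _ _).trans ?_
    gcongr
    refine (NonUnitalStarAlgHom.norm_apply_le π _).trans ?_
    exact (F.fst.le_opNorm e).trans (mul_le_of_le_one_right (norm_nonneg _) he)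
  have hlim : ∀ a v, Tendsto (fun e => π (F.fst e) (π a v)) l (𝓝 (π (F.fst a) v)) := by
    intro a v
    have h1 : Tendsto (fun e => π (F.fst (e * a)) v) l (𝓝 (π (F.fst a) v)) := by
      have : Continuous fun b => π (F.fst b) v :=
        (ContinuousLinearMap.apply ℂ H v).continuous.comp (hπ.comp F.fst.continuous)
      exact (this.tendsto _).comp (hl.tendsto_mul_right a)
    refine h1.congr fun e => ?_
    rw [multiplier_fst_mul, map_mul]
    rfl
  have hzero : ∀ v, (∀ a, π a v = 0) → Tendsto (fun e => π (F.fst e) v) l (𝓝 0) := by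
    intro v hv
    simp only [hv]
    exact tendsto_const_nhds
  -- the vectors along which the net converges form a closed subspace
  let S : Submodule ℂ H :=
    { carrier := {v | ∃ w, Tendsto (fun e => π (F.fst e) v) l (𝓝 w)}
      add_mem' := by
        rintro v v' ⟨w, hw⟩ ⟨w', hw'⟩
        exact ⟨w + w', by simpa only [map_add] using hw.add hw'⟩
      zero_mem' := ⟨0, by simpa only [map_zero] using tendsto_const_nhds⟩
      smul_mem' := by
        rintro c v ⟨w, hw⟩
        exact ⟨c • w, by simpa only [map_smul] using hw.const_smul c⟩ }
  have hS : IsClosed (S : Set H) := by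
    refine isClosed_of_closure_subset fun v hv => ?_
    suffices Cauchy (map (fun e => π (F.fst e) v) l) from CompleteSpace.complete this
    rw [Metric.cauchy_iff]
    refine ⟨inferInstance, fun ε hε => ?_⟩
    obtain ⟨s, ⟨w, hw⟩, hs⟩ := Metric.mem_closure_iff.1 hv (ε / (4 * (‖F.fst‖ + 1))) (by positivity)
    have h1 : ∀ᶠ e in l, π (F.fst e) v ∈ Metric.ball w (ε / 2) := by
      filter_upwards [hbd, (Metric.tendsto_nhds.1 hw (ε / 4) (by positivity))] with e he h2
      have h3 : dist (π (F.fst e) v) (π (F.fst e) s) < ε / 4 := by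
        rw [dist_eq_norm, ← map_sub]
        refine (he _).trans_lt ?_
        rw [dist_eq_norm, lt_div_iff₀ (by positivity)] at hs
        nlinarith [norm_nonneg (v - s), norm_nonneg F.fst]
      rw [Metric.mem_ball]
      linarith [dist_triangle (π (F.fst e) v) (π (F.fst e) s) w]
    refine ⟨Metric.ball w (ε / 2), h1, fun x hx y hy => ?_⟩
    rw [Metric.mem_ball] at hx hy
    linarith [dist_triangle_right x y w]
  have htop : ∀ v, v ∈ S := by
    let E : Submodule ℂ H := (Submodule.span ℂ {v | ∃ a w, π a w = v}).topologicalClosure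
    have hE : E ≤ S := by
      refine Submodule.topologicalClosure_minimal _ (Submodule.span_le.2 ?_) hS
      rintro _ ⟨a, w, rfl⟩
      exact ⟨_, hlim a w⟩
    have hE' : Eᗮ ≤ S := by
      intro v hv
      refine ⟨0, hzero v fun a => ?_⟩
      rw [Submodule.mem_orthogonal] at hv
      have h := hv (π (star a) (π a v))
        (Submodule.le_topologicalClosure _ (Submodule.subset_span ⟨_, _, rfl⟩))
      rw [map_star, ContinuousLinearMap.star_eq_adjoint,
        ContinuousLinearMap.adjoint_inner_left] at h
      exact inner_self_eq_zero.1 h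
    have hc : CompleteSpace E := (Submodule.isClosed_topologicalClosure _).completeSpace_coe
    have : E ⊔ Eᗮ ≤ S := sup_le hE hE'
    rw [Submodule.sup_orthogonal_of_hasOrthogonalProjection] at this
    exact fun v => this trivial
  choose T hT using htop
  have key : ∀ v w, Tendsto (fun e => π (F.fst e) v) l (𝓝 w) → T v = w := fun v w h =>
    tendsto_nhds_unique (hT v) h
  refine ⟨LinearMap.mkContinuous
    { toFun := T
      map_add' := fun v w => key _ _ (by simpa only [map_add] using (hT v).add (hT w))
      map_smul' := fun c v => key _ _ (by simpa only [map_smul, RingHom.id_apply] using (hT v).const_smul c) }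
    ‖F.fst‖ fun v => ?_, fun a v => key _ _ (hlim a v), fun v hv => key _ _ (hzero v hv)⟩
  exact le_of_tendsto (hT v).norm (hbd.mono fun e he => he v)

/-- The extension `π^M(F)` of a representation `π` of a C*-algebra `A` to a multiplier `F`: the
operator with `π^M(F) π(a) = π(Fa)` for all `a ∈ A` (and `π^M(F) = 0` on the orthogonal complement
of `π(A)H`, which is `{0}` when `π` is nondegenerate). -/
noncomputable def multiplierExtension (π : A →⋆ₙₐ[ℂ] (H →L[ℂ] H)) (F : 𝓜(ℂ, A)) : H →L[ℂ] H :=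
  (exists_multiplierExtension π F).choose

theorem multiplierExtension_apply (π : A →⋆ₙₐ[ℂ] (H →L[ℂ] H)) (F : 𝓜(ℂ, A)) (a : A) (v : H) :
    multiplierExtension π F (π a v) = π (F.fst a) v :=
  (exists_multiplierExtension π F).choose_spec.1 a v

end Mult

/-- A topological groupoid: a groupoid with set of arrows `Ξ`, space of units `X`, source map `d`,
range map `r`, and product `ξη` defined when `d ξ = r η`, all structure maps being continuous.
The map `unit` identifies `X` homeomorphically with a subspace of `Ξ`, since `d ∘ unit = id`. -/
structure TopGroupoid (Ξ X : Type*) [TopologicalSpace Ξ] [TopologicalSpace X] where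
  d : Ξ → X
  r : Ξ → X
  unit : X → Ξ
  inv : Ξ → Ξ
  mul : ∀ ξ η : Ξ, d ξ = r η → Ξ
  d_unit : ∀ x, d (unit x) = x
  r_unit : ∀ x, r (unit x) = x
  d_inv : ∀ ξ, d (inv ξ) = r ξ
  r_inv : ∀ ξ, r (inv ξ) = d ξ
  d_mul : ∀ ξ η h, d (mul ξ η h) = d η
  r_mul : ∀ ξ η h, r (mul ξ η h) = r ξ
  mul_assoc : ∀ ξ η ζ (h₁ : d ξ = r η) (h₂ : d η = r ζ),
    mul (mul ξ η h₁) ζ ((d_mul ξ η h₁).trans h₂) = mul ξ (mul η ζ h₂) (h₁.trans (r_mul η ζ h₂).symm)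
  unit_mul : ∀ ξ, mul (unit (r ξ)) ξ (d_unit (r ξ)) = ξ
  mul_unit : ∀ ξ, mul ξ (unit (d ξ)) (r_unit (d ξ)).symm = ξ
  inv_mul : ∀ ξ, mul (inv ξ) ξ (d_inv ξ) = unit (d ξ)
  mul_inv : ∀ ξ, mul ξ (inv ξ) (r_inv ξ).symm = unit (r ξ)
  continuous_d : Continuous d
  continuous_r : Continuous r
  continuous_unit : Continuous unit
  continuous_inv : Continuous inv
  continuous_mul : Continuous fun p : {p : Ξ × Ξ // d p.1 = r p.2} => mul p.1.1 p.1.2 p.2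

namespace TopGroupoid

section Algebra

variable {Ξ X : Type*} [TopologicalSpace Ξ] [TopologicalSpace X] (G : TopGroupoid Ξ X)

/-- The `d`-fibre `Ξ_x = d⁻¹({x})`, with the topology induced from `Ξ`. -/
abbrev Fiber (x : X) : Type _ := {ξ : Ξ // G.d ξ = x}

/-- The orbit `r (Ξ_x)` of the unit `x`. -/
def orbit (x : X) : Set X := {z | ∃ ξ, G.d ξ = x ∧ G.r ξ = z}

/-- The orbit closure generated by the unit `x`. -/
def orbitClosure (x : X) : Set X := closure (G.orbit x)

/-- Right translation `η ↦ ηξ` from the fibre over `r ξ` to the fibre over `d ξ`. -/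
def mulRight (ξ : Ξ) (η : G.Fiber (G.r ξ)) : G.Fiber (G.d ξ) :=
  ⟨G.mul η.1 ξ η.2, G.d_mul _ _ _⟩

variable {G} in
theorem comp_inv {x : X} (ξ η : G.Fiber x) : G.d ξ.1 = G.r (G.inv η.1) :=
  ξ.2.trans (η.2.symm.trans (G.r_inv η.1).symm)

/-- The arrow `ξη⁻¹`, for `ξ` and `η` in the same `d`-fibre. -/
def divFiber {x : X} (ξ η : G.Fiber x) : Ξ := G.mul ξ.1 (G.inv η.1) (comp_inv ξ η)

theorem d_divFiber {x : X} (ξ η : G.Fiber x) : G.d (G.divFiber ξ η) = G.r η.1 :=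
  (G.d_mul _ _ _).trans (G.d_inv _)

theorem continuous_divFiber (x : X) :
    Continuous fun p : G.Fiber x × G.Fiber x => G.divFiber p.1 p.2 := by
  have h : Continuous fun p : G.Fiber x × G.Fiber x =>
      (⟨(p.1.1, G.inv p.2.1), comp_inv p.1 p.2⟩ : {p : Ξ × Ξ // G.d p.1 = G.r p.2}) :=
    ((continuous_subtype_val.comp continuous_fst).prodMk
      (G.continuous_inv.comp (continuous_subtype_val.comp continuous_snd))).subtype_mk _
  exact G.continuous_mul.comp h

theorem continuous_mulRight (ξ : Ξ) : Continuous (G.mulRight ξ) := by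
  have h : Continuous fun η : G.Fiber (G.r ξ) =>
      (⟨(η.1, ξ), η.2⟩ : {p : Ξ × Ξ // G.d p.1 = G.r p.2}) :=
    (continuous_subtype_val.prodMk continuous_const).subtype_mk _
  exact (G.continuous_mul.comp h).subtype_mk _

theorem mul_inv_cancel_right (ζ ξ : Ξ) (h : G.d ζ = G.r ξ) (h' : G.d (G.mul ζ ξ h) = G.r (G.inv ξ)) :
    G.mul (G.mul ζ ξ h) (G.inv ξ) h' = ζ := by
  have h1 := G.mul_assoc ζ ξ (G.inv ξ) h (G.r_inv ξ).symm
  rw [h1]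
  have : ∀ (ε : Ξ) (hε : G.d ζ = G.r ε), ε = G.unit (G.d ζ) → G.mul ζ ε hε = ζ := by
    rintro ε hε rfl
    exact G.mul_unit ζ
  exact this _ _ ((G.mul_inv ξ).trans (by rw [h]))

/-- `(ζη)η⁻¹ = ζ`. -/
theorem divFiber_mulRight_left (η : Ξ) (ζ : G.Fiber (G.r η)) :
    G.divFiber (G.mulRight η ζ) ⟨η, rfl⟩ = ζ.1 :=
  G.mul_inv_cancel_right ζ.1 η ζ.2 _

theorem mul_eq_unit (a b : Ξ) (h : G.d a = G.r b) (h2 : G.mul a b h = G.unit (G.d b)) :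
    a = G.inv b := by
  have h1 := G.mul_inv_cancel_right a b h ((G.d_mul a b h).trans (G.r_inv b).symm)
  rw [← h1]
  have : ∀ (ε : Ξ) (hε : G.d ε = G.r (G.inv b)), ε = G.unit (G.r (G.inv b)) →
      G.mul ε (G.inv b) hε = G.inv b := by
    rintro ε hε rfl
    exact G.unit_mul _
  exact this _ _ (h2.trans (by rw [G.r_inv]))

/-- `ξ(ζξ)⁻¹ = ζ⁻¹`. -/
theorem divFiber_mulRight_right (ξ : Ξ) (ζ : G.Fiber (G.r ξ)) :
    G.divFiber ⟨ξ, rfl⟩ (G.mulRight ξ ζ) = G.inv ζ.1 := by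
  have hd : G.d (G.divFiber ⟨ξ, rfl⟩ (G.mulRight ξ ζ)) = G.r ζ.1 := by
    rw [G.d_divFiber]; exact G.r_mul _ _ _
  refine G.mul_eq_unit _ _ hd ?_
  -- both sides become `ξ` after right multiplication by `ξ`
  have e1 := G.mul_assoc (G.divFiber ⟨ξ, rfl⟩ (G.mulRight ξ ζ)) ζ.1 ξ hd ζ.2
  have e2 : G.mul (G.divFiber ⟨ξ, rfl⟩ (G.mulRight ξ ζ)) (G.mul ζ.1 ξ ζ.2)
      (hd.trans (G.r_mul _ _ ζ.2).symm) = ξ := by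
    have e3 := G.mul_assoc ξ (G.inv (G.mul ζ.1 ξ ζ.2)) (G.mul ζ.1 ξ ζ.2)
      (by rw [G.r_inv, G.d_mul]) (G.d_inv _)
    refine Eq.trans e3 ?_
    have : ∀ (ε : Ξ) (hε : G.d ξ = G.r ε), ε = G.unit (G.d ξ) → G.mul ξ ε hε = ξ := by
      rintro ε hε rfl
      exact G.mul_unit ξ
    exact this _ _ ((G.inv_mul _).trans (by rw [G.d_mul]))
  rw [e2] at e1
  have e4 := G.mul_inv_cancel_right (G.mul (G.divFiber ⟨ξ, rfl⟩ (G.mulRight ξ ζ)) ζ.1 hd) ξ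
    ((G.d_mul _ _ _).trans ζ.2) (by rw [G.d_mul, G.r_inv])
  rw [← e4]
  have : ∀ (ε : Ξ) (hε : G.d ε = G.r (G.inv ξ)), ε = ξ → G.mul ε (G.inv ξ) hε = G.unit (G.r ξ) := by
    rintro ε hε rfl
    exact G.mul_inv _
  rw [this _ _ e1, ζ.2]

/-- A (normalized, continuous) 2-cocycle on the groupoid, with values in the unit circle. -/
structure TwoCocycle where
  toFun : {p : Ξ × Ξ // G.d p.1 = G.r p.2} → Circle
  continuous_toFun : Continuous toFun
  cocycle : ∀ (ξ η ζ : Ξ) (h₁ : G.d ξ = G.r η) (h₂ : G.d η = G.r ζ),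
    toFun ⟨(ξ, η), h₁⟩ * toFun ⟨(G.mul ξ η h₁, ζ), (G.d_mul ξ η h₁).trans h₂⟩ =
      toFun ⟨(η, ζ), h₂⟩ * toFun ⟨(ξ, G.mul η ζ h₂), h₁.trans (G.r_mul η ζ h₂).symm⟩
  unit_left : ∀ η, toFun ⟨(G.unit (G.r η), η), G.d_unit _⟩ = 1
  unit_right : ∀ ξ, toFun ⟨(ξ, G.unit (G.d ξ)), (G.r_unit _).symm⟩ = 1

/-- A right Haar system: Radon measures `λ_x` of full support on the fibres `Ξ_x`, depending
continuously on `x` and carried into one another by right translations. -/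
structure HaarSystem [MeasurableSpace Ξ] where
  measure : ∀ x : X, Measure (G.Fiber x)
  regular : ∀ x, (measure x).Regular
  isOpenPosMeasure : ∀ x, (measure x).IsOpenPosMeasure
  continuous_integral : ∀ f : CompactlySupportedContinuousMap Ξ ℂ,
    Continuous fun x => ∫ η : G.Fiber x, f η.1 ∂(measure x)
  map_mulRight : ∀ ξ : Ξ, (measure (G.r ξ)).map (G.mulRight ξ) = measure (G.d ξ)

end Algebra

section Analysis

variable {Ξ X : Type*} [TopologicalSpace Ξ] [TopologicalSpace X]

theorem t2Space_units (G : TopGroupoid Ξ X) [T2Space Ξ] : T2Space X :=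
  T2Space.of_injective_continuous
    (Function.LeftInverse.injective (g := G.d) G.d_unit) G.continuous_unit

theorem isClosedEmbedding_fiber (G : TopGroupoid Ξ X) [T2Space Ξ] (x : X) :
    IsClosedEmbedding (Subtype.val : G.Fiber x → Ξ) := by
  have := G.t2Space_units
  exact (isClosed_singleton.preimage G.continuous_d).isClosedEmbedding_subtypeVal

variable {G : TopGroupoid Ξ X}

/-- The Hilbert space `L²(Ξ_x; λ_x)`. -/
abbrev HaarSystem.L2 [MeasurableSpace Ξ] (μ : G.HaarSystem) (x : X) : Type _ := Lp ℂ 2 (μ.measure x)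

/-- The integral kernel `f(ξη⁻¹) ω(ξη⁻¹, η)` on `Ξ_x × Ξ_x`. -/
noncomputable def kernel (ω : G.TwoCocycle) (f : CompactlySupportedContinuousMap Ξ ℂ) (x : X)
    (p : G.Fiber x × G.Fiber x) : ℂ :=
  f (G.divFiber p.1 p.2) * (ω.toFun ⟨(G.divFiber p.1 p.2, p.2.1), G.d_divFiber p.1 p.2⟩ : ℂ)

/-- The twisted convolution
`(f ⋆_ω u)(ξ) = ∫ f(ξη⁻¹) u(η) ω(ξη⁻¹, η) dλ_x(η)`, for `u` a function on `Ξ_x` and `ξ ∈ Ξ_x`. -/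
noncomputable def twistedConv [MeasurableSpace Ξ] (μ : G.HaarSystem) (ω : G.TwoCocycle)
    (f : CompactlySupportedContinuousMap Ξ ℂ) {x : X} (u : G.Fiber x → ℂ) (ξ : G.Fiber x) : ℂ :=
  ∫ η, kernel ω f x (ξ, η) * u η ∂(μ.measure x)

theorem continuous_kernel (ω : G.TwoCocycle) (f : CompactlySupportedContinuousMap Ξ ℂ) (x : X) :
    Continuous (kernel ω f x) := by
  have h := G.continuous_divFiber x
  refine (f.continuous.comp h).mul (continuous_subtype_val.comp (ω.continuous_toFun.comp ?_))
  exact (h.prodMk (continuous_subtype_val.comp continuous_snd)).subtype_mk _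

theorem enorm_kernel (ω : G.TwoCocycle) (f : CompactlySupportedContinuousMap Ξ ℂ) (x : X)
    (ξ η : G.Fiber x) : ‖kernel ω f x (ξ, η)‖ₑ = ‖f (G.divFiber ξ η)‖ₑ := by
  simp only [kernel, enorm_mul]
  rw [← ofReal_norm (ω.toFun _ : ℂ), Circle.norm_coe, ENNReal.ofReal_one, mul_one]

variable [MeasurableSpace Ξ] [T2Space Ξ] [BorelSpace Ξ]

theorem exists_lintegral_bound (μ : G.HaarSystem) (f : CompactlySupportedContinuousMap Ξ ℂ) :
    ∃ C : ℝ≥0, ∀ z, ∫⁻ ζ : G.Fiber z, ‖f ζ.1‖ₑ ∂(μ.measure z) ≤ C := by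
  let g : CompactlySupportedContinuousMap Ξ ℂ :=
    ⟨⟨fun ξ => (‖f ξ‖ : ℂ), Complex.continuous_ofReal.comp f.continuous.norm⟩,
      f.hasCompactSupport.comp_left (g := fun z : ℂ => (‖z‖ : ℂ)) (by simp)⟩
  have hK : IsCompact (G.d '' tsupport f) := f.hasCompactSupport.image G.continuous_d
  obtain ⟨C, hC⟩ := hK.exists_bound_of_continuousOn (μ.continuous_integral g).continuousOn
  refine ⟨C.toNNReal, fun z => ?_⟩
  have := μ.regular z
  have hint : Integrable (fun ζ : G.Fiber z => f ζ.1) (μ.measure z) :=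
    (f.continuous.comp continuous_subtype_val).integrable_of_hasCompactSupport
      (f.hasCompactSupport.comp_isClosedEmbedding (G.isClosedEmbedding_fiber z))
  by_cases hz : z ∈ G.d '' tsupport f
  · have h1 := hC z hz
    have h2 : ∫ ζ : G.Fiber z, g ζ.1 ∂(μ.measure z) =
        ((∫ ζ : G.Fiber z, ‖f ζ.1‖ ∂(μ.measure z) : ℝ) : ℂ) := integral_ofReal
    rw [h2, Complex.norm_real, Real.norm_eq_abs] at h1
    rw [← ofReal_integral_norm_eq_lintegral_enorm hint]
    exact ENNReal.ofReal_le_ofReal ((le_abs_self _).trans h1)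
  · have : ∀ ζ : G.Fiber z, f ζ.1 = 0 := fun ζ => by
      by_contra h
      exact hz ⟨ζ.1, subset_tsupport _ h, ζ.2⟩
    simp [this]

variable [LocallyCompactSpace Ξ] [SigmaCompactSpace Ξ]

theorem exists_regularRep (μ : G.HaarSystem) (ω : G.TwoCocycle)
    (f : CompactlySupportedContinuousMap Ξ ℂ) :
    ∃ C : ℝ≥0, ∀ x, ∃ T : μ.L2 x →L[ℂ] μ.L2 x, ‖T‖ ≤ C ∧
      ∀ u : μ.L2 x, T u =ᵐ[μ.measure x] twistedConv μ ω f u := by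
  let f' : CompactlySupportedContinuousMap Ξ ℂ :=
    ⟨⟨fun ξ => f (G.inv ξ), f.continuous.comp G.continuous_inv⟩, by
      have hinv : ∀ ξ, G.inv (G.inv ξ) = ξ := fun ξ =>
        (G.mul_eq_unit ξ (G.inv ξ) (G.r_inv ξ).symm
          ((G.mul_inv ξ).trans (by rw [G.d_inv]))).symm
      let e : Ξ ≃ₜ Ξ := ⟨⟨G.inv, G.inv, hinv, hinv⟩, G.continuous_inv, G.continuous_inv⟩
      exact f.hasCompactSupport.comp_homeomorph e⟩
  obtain ⟨C₁, hC₁⟩ := exists_lintegral_bound μ f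
  obtain ⟨C₂, hC₂⟩ := exists_lintegral_bound μ f'
  refine ⟨max C₁ C₂, fun x => ?_⟩
  have hx := G.isClosedEmbedding_fiber x
  have : LocallyCompactSpace (G.Fiber x) := hx.locallyCompactSpace
  have : SigmaCompactSpace (G.Fiber x) := hx.sigmaCompactSpace
  have := μ.regular x
  have hm : ∀ (ξ : Ξ), Measurable (G.mulRight ξ) := fun ξ => (G.continuous_mulRight ξ).measurable
  refine schur_test (stronglyMeasurable_of_continuous_prod (continuous_kernel ω f x))
    (fun ξ => ?_) (fun η => ?_)
  · simp only [enorm_kernel]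
    obtain ⟨ξ, rfl⟩ := ξ
    have hc : Continuous fun η : G.Fiber (G.d ξ) => G.divFiber ⟨ξ, rfl⟩ η :=
      (G.continuous_divFiber _).comp (Continuous.prodMk_right _)
    rw [← μ.map_mulRight ξ, lintegral_map (f := fun a => ‖f _‖ₑ) (f.continuous.comp hc).measurable.enorm (hm ξ)]
    simp only [G.divFiber_mulRight_right]
    exact (hC₂ _).trans (by exact_mod_cast le_max_right _ _)
  · simp only [enorm_kernel]
    obtain ⟨η, rfl⟩ := η
    have hc : Continuous fun ξ : G.Fiber (G.d η) => G.divFiber ξ ⟨η, rfl⟩ :=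
      (G.continuous_divFiber _).comp (Continuous.prodMk_left _)
    rw [← μ.map_mulRight η, lintegral_map (f := fun a => ‖f _‖ₑ) (f.continuous.comp hc).measurable.enorm (hm η)]
    simp only [G.divFiber_mulRight_left]
    exact (hC₁ _).trans (by exact_mod_cast le_max_left _ _)

/-- The regular representation `Π_x(f) u = f ⋆_ω u` of `f ∈ C_c(Ξ)` on `L²(Ξ_x; λ_x)`. -/
noncomputable def regularRep (μ : G.HaarSystem) (ω : G.TwoCocycle)
    (f : CompactlySupportedContinuousMap Ξ ℂ) (x : X) : μ.L2 x →L[ℂ] μ.L2 x :=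
  ((exists_regularRep μ ω f).choose_spec x).choose

theorem regularRep_apply (μ : G.HaarSystem) (ω : G.TwoCocycle)
    (f : CompactlySupportedContinuousMap Ξ ℂ) (x : X) (u : μ.L2 x) :
    regularRep μ ω f x u =ᵐ[μ.measure x] twistedConv μ ω f u :=
  ((exists_regularRep μ ω f).choose_spec x).choose_spec.2 u

/-- The C*-algebra of all bounded families of operators `T_x ∈ B(L²(Ξ_x; λ_x))`, `x ∈ X`, with
pointwise operations and the norm `sup_x ‖T_x‖`. -/
def HaarSystem.BoundedField (μ : G.HaarSystem) : Type _ :=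
  lp (fun x : X => μ.L2 x →L[ℂ] μ.L2 x) ∞

noncomputable instance (μ : G.HaarSystem) : NonUnitalCStarAlgebra μ.BoundedField :=
  inferInstanceAs (NonUnitalCStarAlgebra (lp (fun x : X => μ.L2 x →L[ℂ] μ.L2 x) ∞))

/-- The component `T_x` of a bounded family `T`. -/
def HaarSystem.BoundedField.component {μ : G.HaarSystem} (T : μ.BoundedField) (x : X) :
    μ.L2 x →L[ℂ] μ.L2 x :=
  (show lp (fun x : X => μ.L2 x →L[ℂ] μ.L2 x) ∞ from T) x

/-- The bounded family `(Π_x(f))_x`; its norm `sup_x ‖Π_x(f)‖` is the reduced norm of `f`. -/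
noncomputable def regularField (μ : G.HaarSystem) (ω : G.TwoCocycle)
    (f : CompactlySupportedContinuousMap Ξ ℂ) : μ.BoundedField :=
  ⟨fun x => regularRep μ ω f x, memℓp_infty ⟨(exists_regularRep μ ω f).choose, by
    rintro _ ⟨x, rfl⟩
    exact ((exists_regularRep μ ω f).choose_spec x).choose_spec.1⟩⟩

/-- The reduced twisted groupoid C*-algebra, realized through the (jointly faithful) regular
representations: the C*-algebra generated by the families `(Π_x(f))_x`, `f ∈ C_c(Ξ)`. Since
`Π_x(f) Π_x(g) = Π_x(f ⋆_ω g)` and `Π_x(f)^* = Π_x(f^{⋆_ω})`, it is the completion of the twisted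
convolution algebra `C_c(Ξ, ω)` in the reduced norm. -/
noncomputable def reducedAlgebra (μ : G.HaarSystem) (ω : G.TwoCocycle) :
    NonUnitalStarSubalgebra ℂ μ.BoundedField :=
  (NonUnitalStarAlgebra.adjoin ℂ (Set.range (regularField μ ω))).topologicalClosure

instance isClosed_reducedAlgebra (μ : G.HaarSystem) (ω : G.TwoCocycle) :
    IsClosed (reducedAlgebra μ ω : Set μ.BoundedField) :=
  NonUnitalStarSubalgebra.isClosed_topologicalClosure _

noncomputable instance (μ : G.HaarSystem) (ω : G.TwoCocycle) :
    NonUnitalCStarAlgebra (reducedAlgebra μ ω) :=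
  NonUnitalStarSubalgebra.nonUnitalCStarAlgebra (reducedAlgebra μ ω)

/-- The regular representation `Π_x` of the reduced twisted groupoid C*-algebra. -/
noncomputable def reducedRep (μ : G.HaarSystem) (ω : G.TwoCocycle) (x : X) :
    reducedAlgebra μ ω →⋆ₙₐ[ℂ] (μ.L2 x →L[ℂ] μ.L2 x) where
  toFun c := c.1.component x
  map_smul' _ _ := rfl
  map_zero' := rfl
  map_add' _ _ := rfl
  map_mul' _ _ := rfl
  map_star' _ := rfl

/-- The operator `H_x = Π_x^M(F)` on `L²(Ξ_x; λ_x)` attached to a multiplier `F`. -/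
noncomputable def fiberOperator (μ : G.HaarSystem) (ω : G.TwoCocycle)
    (F : 𝓜(ℂ, reducedAlgebra μ ω)) (x : X) : μ.L2 x →L[ℂ] μ.L2 x :=
  multiplierExtension (reducedRep μ ω x) F

end Analysis

end TopGroupoid

/-- A C*-algebraic spectral set: a closed set `Σ(a | A)` of complex numbers for every element `a`
of every unital C*-algebra `A`, which shrinks under unital *-morphisms and is preserved by the
injective ones. -/
structure CStarSpectralSet where
  toFun : ∀ (A : Type u) [CStarAlgebra A], A → Set ℂ
  isClosed : ∀ (A : Type u) [CStarAlgebra A] (a : A), IsClosed (toFun A a)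
  map_subset : ∀ (A B : Type u) [CStarAlgebra A] [CStarAlgebra B] (π : A →⋆ₐ[ℂ] B) (a : A),
    toFun B (π a) ⊆ toFun A a
  map_eq : ∀ (A B : Type u) [CStarAlgebra A] [CStarAlgebra B] (π : A →⋆ₐ[ℂ] B),
    Function.Injective π → ∀ a : A, toFun B (π a) = toFun A a

section SpectralExamples

variable {A : Type*} [CStarAlgebra A]

/-- The `ε`-pseudospectrum `{λ | ‖(a - λ)⁻¹‖ ≥ 1/ε}`, with `‖(a - λ)⁻¹‖ = ∞` when `a - λ` is not
invertible. -/
def pseudospectrum (ε : ℝ) (a : A) : Set ℂ :=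
  {z | ∀ b : A, b * (a - algebraMap ℂ A z) = 1 → (a - algebraMap ℂ A z) * b = 1 → 1 / ε ≤ ‖b‖}

/-- The numerical range: the set of values at `a` of all states. -/
def numericalRange (a : A) : Set ℂ :=
  {z | ∃ φ : A →ₗ[ℂ] ℂ, (∀ b, 0 ≤ φ (star b * b)) ∧ φ 1 = 1 ∧ φ a = z}

/-- The polynomial hull `{λ | |p(λ)| ≤ ‖p(a)‖}` attached to a polynomial `p`. -/
def polynomialHull (p : Polynomial ℂ) (a : A) : Set ℂ :=
  {z | ‖p.eval z‖ ≤ ‖Polynomial.aeval a p‖}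

end SpectralExamples

/-!
The regular representations `Π_x` of the reduced algebra are compared through the norms
`‖Π_x(a)‖`.

Along an orbit these norms are constant: right translation by an arrow `ξ`, corrected by the phase
`conj (ω(·, ξ))`, is an isometry between the fibre spaces that intertwines `Π_{d(ξ)}` and
`Π_{r(ξ)}` (`translation_component`). Restrictions of functions `φ ∈ C_c(Ξ)` to the fibres form a
dense family of sections of the field `x ↦ L²(Ξ_x; λ_x)`, their norms are continuous in `x` by the
axioms of a Haar system, and the generators `Π_x(f)` preserve such sections, since `f ⋆_ω φ` is
again in `C_c(Ξ)`. Hence `x ↦ ‖Π_x(a)‖` is lower semicontinuous, and `‖Π_x(a)‖ ≤ ‖Π_y(a)‖` for all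
`a` whenever `x` lies in the closure of the orbit of `y`
(`norm_component_le_of_mem_orbitClosure`).

Each `Π_x` is nondegenerate (`isNondegenerate_reducedRep`): a vector `w` killed by all `Π_x(f)`
makes `f* ⋆_ω w` vanish almost everywhere, this function is continuous near the unit of `Ξ_x`, the
measure has full support, and the value at the unit is the inner product of `f` with `w`.

To pass to multipliers, let `J` be the closure of `{(Π_y(a), Π_x(a))}` in `B(L²(Ξ_y)) ×
B(L²(Ξ_x))`. The pair of operators `(H_y, H_x)` belongs to the idealizer of `J`, a unital
C*-algebra. If `Π_x` is dominated by `Π_y` and `Π_x` is nondegenerate, then the first projection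
is injective on this idealizer, because an element `(0, T)` of it satisfies `T Π_x(a) = 0` for all
`a` (`exists_common_lift`). So `Σ(H_y)` equals the spectral set of the pair in the idealizer, and
the second projection maps the pair to `H_x`. When the two orbit closures coincide both
projections are injective, and the spectrum, the pseudospectra, the numerical range and the
polynomial hulls are all invariant under injective unital `*`-morphisms.
-/

/-! ### Spectral quantities under injective `*`-morphisms -/

section Permanence

variable {A B : Type*} [CStarAlgebra A] [CStarAlgebra B]

theorem spectrum_map_of_injective (π : A →⋆ₐ[ℂ] B) (hπ : Function.Injective π) (a : A) :
    spectrum ℂ (π a) = spectrum ℂ a := by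
  have hc : IsClosed (π.range : Set B) := by
    have := (NonUnitalStarAlgHom.isometry π hπ).isClosedEmbedding.isClosed_range
    exact this
  have h1 := StarSubalgebra.spectrum_eq (hS := hc) (a := StarAlgEquiv.ofInjective π hπ a)
  rw [AlgEquiv.spectrum_eq (StarAlgEquiv.ofInjective π hπ) a] at h1
  exact h1.symm

theorem isUnit_of_isUnit_map (π : A →⋆ₐ[ℂ] B) (hπ : Function.Injective π) {a : A}
    (h : IsUnit (π a)) : IsUnit a := by
  rw [← spectrum.zero_notMem_iff ℂ] at h ⊢
  rwa [← spectrum_map_of_injective π hπ]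

theorem pseudospectrum_map_of_injective (π : A →⋆ₐ[ℂ] B) (hπ : Function.Injective π) (ε : ℝ)
    (a : A) : pseudospectrum ε (π a) = pseudospectrum ε a := by
  have hsub : ∀ z, π a - algebraMap ℂ B z = π (a - algebraMap ℂ A z) := fun z => by
    rw [map_sub, AlgHomClass.commutes]
  ext z
  simp only [pseudospectrum, Set.mem_ofPred_eq, hsub]
  refine ⟨fun h b h₁ h₂ => ?_, fun h b h₁ h₂ => ?_⟩
  · rw [← NonUnitalStarAlgHom.norm_map π hπ b]
    exact h _ (by rw [← map_mul, h₁, map_one]) (by rw [← map_mul, h₂, map_one])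
  · obtain ⟨c, hc⟩ := isUnit_of_isUnit_map π hπ ⟨⟨_, b, h₂, h₁⟩, rfl⟩
    have hb : b = π ↑c⁻¹ := by
      refine left_inv_eq_right_inv h₁ ?_
      rw [← map_mul, ← hc, Units.mul_inv, map_one]
    rw [hb, NonUnitalStarAlgHom.norm_map π hπ]
    exact h _ (by rw [← hc, Units.inv_mul]) (by rw [← hc, Units.mul_inv])

theorem polynomialHull_map_of_injective (π : A →⋆ₐ[ℂ] B) (hπ : Function.Injective π)
    (p : Polynomial ℂ) (a : A) : polynomialHull p (π a) = polynomialHull p a := by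
  have : Polynomial.aeval (π a) p = π (Polynomial.aeval a p) :=
    Polynomial.aeval_algHom_apply π.toAlgHom a p
  simp only [polynomialHull, this, NonUnitalStarAlgHom.norm_map π hπ]

/-- States are contractive. -/
theorem norm_state_apply_le (φ : A →ₗ[ℂ] ℂ) (hφ : ∀ b, 0 ≤ φ (star b * b)) (h1 : φ 1 = 1)
    (a : A) : ‖φ a‖ ≤ ‖a‖ := by
  let _ : PartialOrder A := CStarAlgebra.spectralOrder A
  have _ : StarOrderedRing A := CStarAlgebra.spectralOrderedRing A
  let f : A →ₚ[ℂ] ℂ := PositiveLinearMap.mk₀ φ fun x hx => by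
    obtain ⟨b, rfl⟩ := CStarAlgebra.nonneg_iff_eq_star_mul_self.1 hx
    exact hφ b
  have hf : ∀ x, f x = φ x := fun _ => rfl
  have hone : ‖f.toPreGNS 1‖ = 1 := by
    have := f.preGNS_norm_sq (f.toPreGNS 1)
    simp only [PositiveLinearMap.ofPreGNS_toPreGNS, star_one, mul_one, hf, h1] at this
    have h2 : ‖f.toPreGNS 1‖ ^ 2 = 1 := by exact_mod_cast this
    exact (pow_eq_one_iff_of_nonneg (norm_nonneg _) two_ne_zero).1 h2
  have ha : ‖f.toPreGNS a‖ ≤ ‖a‖ := by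
    have h3 := f.preGNS_norm_sq (f.toPreGNS a)
    simp only [PositiveLinearMap.ofPreGNS_toPreGNS, hf] at h3
    have h4 : φ (star a * a) ≤ φ (algebraMap ℝ A (‖a‖ ^ 2)) := by
      rw [← hf, ← hf]
      refine f.monotone' ?_
      have := IsSelfAdjoint.le_algebraMap_norm_self (IsSelfAdjoint.star_mul_self a)
      rwa [CStarRing.norm_star_mul_self, ← sq] at this
    rw [← h3, IsScalarTower.algebraMap_apply ℝ ℂ A, Algebra.algebraMap_eq_smul_one, map_smul, h1,
      smul_eq_mul, mul_one] at h4
    have h5 : ‖f.toPreGNS a‖ ^ 2 ≤ ‖a‖ ^ 2 := by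
      rw [← Complex.real_le_real]; push_cast at h4 ⊢; simpa using h4
    exact (sq_le_sq₀ (norm_nonneg _) (norm_nonneg _)).1 h5
  have h6 := norm_inner_le_norm (𝕜 := ℂ) (f.toPreGNS 1) (f.toPreGNS a)
  rw [PositiveLinearMap.preGNS_inner_def] at h6
  simp only [PositiveLinearMap.ofPreGNS_toPreGNS, star_one, one_mul, hf, hone] at h6
  exact h6.trans ha

/-- A contractive functional taking the value `1` at the identity is positive. -/
theorem nonneg_apply_of_norm_le_one (g : A →L[ℂ] ℂ) (hg : ‖g‖ ≤ 1) (h1 : g 1 = 1) (b : A) :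
    0 ≤ g (star b * b) := by
  let _ : PartialOrder A := CStarAlgebra.spectralOrder A
  have _ : StarOrderedRing A := CStarAlgebra.spectralOrderedRing A
  have hle : ∀ x, ‖g x‖ ≤ ‖x‖ := fun x => g.le_of_opNorm_le hg x |>.trans_eq (one_mul _)
  set c := star b * b with hc
  have hsa : IsSelfAdjoint c := IsSelfAdjoint.star_mul_self b
  have hc0 : 0 ≤ c := star_mul_self_nonneg b
  have hnt : Nontrivial A := by
    by_contra h
    rw [not_nontrivial_iff_subsingleton] at h
    rw [Subsingleton.elim (1 : A) 0, map_zero] at h1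
    exact zero_ne_one h1
  -- the imaginary part vanishes, as `|g c + it|² ≤ ‖c + it‖² ≤ ‖c‖² + t²` for all real `t`
  have him : (g c).im = 0 := by
    have key : ∀ t : ℝ, ((g c).re) ^ 2 + ((g c).im + t) ^ 2 ≤ ‖c‖ ^ 2 + t ^ 2 := fun t => by
      have h2 := hle (c + (t * Complex.I : ℂ) • (1 : A))
      rw [map_add, map_smul, h1, smul_eq_mul, mul_one] at h2
      have h3 : ‖c + (t * Complex.I : ℂ) • (1 : A)‖ ^ 2 ≤ ‖c‖ ^ 2 + t ^ 2 := by
        rw [sq, ← CStarRing.norm_star_mul_self]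
        have : star (c + (t * Complex.I : ℂ) • (1 : A)) * (c + (t * Complex.I : ℂ) • (1 : A)) =
            c * c + ((t ^ 2 : ℝ) : ℂ) • (1 : A) := by
          rw [star_add, hsa.star_eq, star_smul, star_one]
          simp only [Complex.star_def, map_mul, Complex.conj_ofReal, Complex.conj_I, mul_add,
            add_mul, smul_mul_assoc, mul_smul_comm, one_mul, mul_one, smul_add]
          have e : (t * -Complex.I : ℂ) * (t * Complex.I) = ((t ^ 2 : ℝ) : ℂ) := by
            push_cast
            linear_combination (-(t : ℂ) ^ 2) * Complex.I_sq
          rw [smul_smul, mul_comm (t * Complex.I : ℂ), e, mul_neg, neg_smul]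
          abel
        rw [this]
        refine (norm_add_le _ _).trans ?_
        gcongr
        · exact (norm_mul_le _ _).trans_eq (sq _).symm
        · rw [norm_smul, Complex.norm_real, norm_one, mul_one, Real.norm_eq_abs,
            abs_of_nonneg (sq_nonneg t)]
      have h4 : ‖g c + t * Complex.I‖ ^ 2 = ((g c).re) ^ 2 + ((g c).im + t) ^ 2 := by
        rw [← Complex.normSq_eq_norm_sq, Complex.normSq_apply]
        simp
        ring
      rw [← h4]
      exact (pow_le_pow_left₀ (norm_nonneg _) h2 2).trans h3
    by_contra hne
    have h5 := key ((‖c‖ ^ 2 + 1) / (2 * (g c).im))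
    have h6 : 2 * (g c).im * ((‖c‖ ^ 2 + 1) / (2 * (g c).im)) = ‖c‖ ^ 2 + 1 := by
      field_simp
    nlinarith [sq_nonneg (g c).re, sq_nonneg (g c).im]
  -- and `|‖c‖ - g c| ≤ ‖‖c‖ - c‖ ≤ ‖c‖`
  have hre : 0 ≤ (g c).re := by
    have h2 : ‖algebraMap ℝ A ‖c‖ - c‖ ≤ ‖c‖ := by
      have h3 : algebraMap ℝ A ‖c‖ - c ≤ algebraMap ℝ A ‖c‖ := sub_le_self _ hc0
      have h4 : 0 ≤ algebraMap ℝ A ‖c‖ - c :=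
        sub_nonneg.2 (IsSelfAdjoint.le_algebraMap_norm_self hsa)
      exact (CStarAlgebra.norm_le_iff_le_algebraMap _ (norm_nonneg _) h4).2 h3
    have h5 := (hle _).trans h2
    rw [map_sub, IsScalarTower.algebraMap_apply ℝ ℂ A, Algebra.algebraMap_eq_smul_one, map_smul,
      h1, smul_eq_mul, mul_one] at h5
    have h6 := (Complex.abs_re_le_norm _).trans h5
    have h7 := (abs_le.1 h6).2
    simp at h7
    linarith
  exact Complex.le_def.2 ⟨hre, him.symm⟩

/-- States restrict along `π`, and states of a subalgebra extend by the Hahn–Banach theorem. -/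
theorem numericalRange_map_of_injective (π : A →⋆ₐ[ℂ] B) (hπ : Function.Injective π) (a : A) :
    numericalRange (π a) = numericalRange a := by
  ext z
  constructor
  · rintro ⟨φ, hφ, h1, rfl⟩
    refine ⟨φ ∘ₗ π.toAlgHom.toLinearMap, fun b => ?_, ?_, rfl⟩
    · have := hφ (π b)
      rwa [← map_star, ← map_mul] at this
    · change φ (π 1) = 1
      rw [map_one, h1]
  · rintro ⟨φ, hφ, h1, rfl⟩
    let L : A →ₗ[ℂ] B := π.toAlgHom.toLinearMap
    let e : A ≃ₗ[ℂ] LinearMap.range L := LinearEquiv.ofInjective L hπ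
    have he : ∀ x, ((e x : LinearMap.range L) : B) = π x := fun _ => rfl
    let f : StrongDual ℂ (LinearMap.range L) :=
      LinearMap.mkContinuous (φ ∘ₗ e.symm.toLinearMap) 1 fun y => by
        obtain ⟨x, rfl⟩ := e.surjective y
        simp only [LinearMap.comp_apply, LinearEquiv.coe_coe, LinearEquiv.symm_apply_apply, one_mul]
        rw [show ‖e x‖ = ‖π x‖ from rfl, NonUnitalStarAlgHom.norm_map π hπ]
        exact norm_state_apply_le φ hφ h1 x
    obtain ⟨g, hg, hgf⟩ := exists_extension_norm_eq (LinearMap.range L) f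
    have hgπ : ∀ x, g (π x) = φ x := fun x => by
      rw [← he, hg]
      change φ (e.symm (e x)) = φ x
      rw [LinearEquiv.symm_apply_apply]
    have hg1 : g 1 = 1 := by rw [← map_one π, hgπ, h1]
    refine ⟨g.toLinearMap, fun b => ?_, hg1, hgπ a⟩
    exact nonneg_apply_of_norm_le_one g (hgf ▸ LinearMap.mkContinuous_norm_le _ zero_le_one _) hg1 b

end Permanence

/-! ### Multipliers and two representations at once -/

section Idealizer

/-- The idealizer of a `*`-subalgebra `J` of `B`: the largest `*`-subalgebra of `B` that contains
`J` as a two-sided ideal. -/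
def NonUnitalStarSubalgebra.idealizer {B : Type*} [CStarAlgebra B]
    (J : NonUnitalStarSubalgebra ℂ B) : StarSubalgebra ℂ B where
  carrier := {p | ∀ j ∈ J, p * j ∈ J ∧ j * p ∈ J}
  mul_mem' {p q} hp hq j hj := by
    refine ⟨?_, ?_⟩
    · rw [mul_assoc]; exact (hp _ (hq j hj).1).1
    · rw [← mul_assoc]; exact (hq _ (hp j hj).2).2
  add_mem' {p q} hp hq j hj := by
    rw [add_mul, mul_add]
    exact ⟨add_mem (hp j hj).1 (hq j hj).1, add_mem (hp j hj).2 (hq j hj).2⟩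
  algebraMap_mem' z j hj := by
    rw [← Algebra.commutes, ← Algebra.smul_def]
    exact ⟨SMulMemClass.smul_mem z hj, SMulMemClass.smul_mem z hj⟩
  star_mem' {p} hp j hj := by
    refine ⟨?_, ?_⟩
    · have := star_mem (hp _ (star_mem hj)).2
      rwa [star_mul, star_star] at this
    · have := star_mem (hp _ (star_mem hj)).1
      rwa [star_mul, star_star] at this

theorem NonUnitalStarSubalgebra.mem_idealizer {B : Type*} [CStarAlgebra B]
    {J : NonUnitalStarSubalgebra ℂ B} {p : B} :
    p ∈ J.idealizer ↔ ∀ j ∈ J, p * j ∈ J ∧ j * p ∈ J := Iff.rfl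

theorem NonUnitalStarSubalgebra.isClosed_idealizer {B : Type*} [CStarAlgebra B]
    {J : NonUnitalStarSubalgebra ℂ B} (hJ : IsClosed (J : Set B)) :
    IsClosed (J.idealizer : Set B) := by
  have : (J.idealizer : Set B) =
      ⋂ j ∈ J, ((fun p => p * j) ⁻¹' (J : Set B) ∩ (fun p => j * p) ⁻¹' (J : Set B)) := by
    ext p
    simp [NonUnitalStarSubalgebra.mem_idealizer]
  rw [this]
  exact isClosed_biInter fun j _ =>
    (hJ.preimage (continuous_mul_const j)).inter (hJ.preimage (continuous_const_mul j))

variable {A : Type*} [NonUnitalCStarAlgebra A]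

/-- A representation `π` of a C*-algebra on a Hilbert space is nondegenerate if no nonzero vector
is annihilated by all the operators `π a`. -/
def IsNondegenerate {H : Type*} [NormedAddCommGroup H] [InnerProductSpace ℂ H] [CompleteSpace H]
    (π : A →⋆ₙₐ[ℂ] (H →L[ℂ] H)) : Prop :=
  ∀ v, (∀ a, π a v = 0) → v = 0

section OneRepresentation

variable {H : Type*} [NormedAddCommGroup H] [InnerProductSpace ℂ H] [CompleteSpace H]
  {π : A →⋆ₙₐ[ℂ] (H →L[ℂ] H)}

theorem IsNondegenerate.eq_zero_of_mul (hπ : IsNondegenerate π) {T : H →L[ℂ] H}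
    (h : ∀ a, T * π a = 0) : T = 0 := by
  rw [← star_eq_zero]
  ext v
  refine hπ _ fun a => ?_
  have : π a * star T = 0 := by
    rw [← star_star (π a), ← map_star, ← star_mul, h, star_zero]
  exact DFunLike.congr_fun this v

theorem multiplierExtension_mul (π : A →⋆ₙₐ[ℂ] (H →L[ℂ] H)) (F : 𝓜(ℂ, A)) (a : A) :
    multiplierExtension π F * π a = π (F.fst a) :=
  ContinuousLinearMap.ext fun v => multiplierExtension_apply π F a v

/-- Nondegeneracy makes the extension compatible with right multiplication by `F` as well. -/
theorem IsNondegenerate.mul_multiplierExtension (hπ : IsNondegenerate π) (F : 𝓜(ℂ, A)) (a : A) :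
    π a * multiplierExtension π F = π (F.snd a) := by
  rw [← sub_eq_zero]
  refine hπ.eq_zero_of_mul fun b => ?_
  rw [sub_mul, mul_assoc, multiplierExtension_mul, ← map_mul, ← map_mul, F.central, sub_self]

end OneRepresentation

variable {H K : Type u} [NormedAddCommGroup H] [InnerProductSpace ℂ H] [CompleteSpace H]
  [NormedAddCommGroup K] [InnerProductSpace ℂ K] [CompleteSpace K]

/-- The extensions of two nondegenerate representations `π` and `ρ` to a multiplier `F` are the
images of one element `h` of a unital C*-algebra `E`. The morphism `p` carrying `h` to `π^M(F)` is
injective as soon as `ρ` is dominated by `π`, and symmetrically.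

Here `E` is the idealizer of the closure of `{(π a, ρ a) | a ∈ A}` in `B(H) × B(K)`. -/
theorem exists_common_lift {π : A →⋆ₙₐ[ℂ] (H →L[ℂ] H)} {ρ : A →⋆ₙₐ[ℂ] (K →L[ℂ] K)}
    (hπ : IsNondegenerate π) (hρ : IsNondegenerate ρ) (F : 𝓜(ℂ, A)) :
    ∃ (E : Type u) (_ : CStarAlgebra E) (p : E →⋆ₐ[ℂ] (H →L[ℂ] H)) (q : E →⋆ₐ[ℂ] (K →L[ℂ] K))
      (h : E), p h = multiplierExtension π F ∧ q h = multiplierExtension ρ F ∧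
      ((∀ a, ‖ρ a‖ ≤ ‖π a‖) → Function.Injective p) ∧
      ((∀ a, ‖π a‖ ≤ ‖ρ a‖) → Function.Injective q) := by
  let P : A →⋆ₙₐ[ℂ] ((H →L[ℂ] H) × (K →L[ℂ] K)) := π.prod ρ
  let J : NonUnitalStarSubalgebra ℂ ((H →L[ℂ] H) × (K →L[ℂ] K)) :=
    (NonUnitalStarAlgHom.range P).topologicalClosure
  have hJ : IsClosed (J : Set ((H →L[ℂ] H) × (K →L[ℂ] K))) :=
    NonUnitalStarSubalgebra.isClosed_topologicalClosure _
  have hPJ : ∀ a, P a ∈ J := fun a =>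
    NonUnitalStarSubalgebra.le_topologicalClosure _ ⟨a, rfl⟩
  -- closed conditions on elements of `J` may be checked on the pairs `(π a, ρ a)`
  have hind : ∀ S : Set ((H →L[ℂ] H) × (K →L[ℂ] K)), IsClosed S → (∀ a, P a ∈ S) →
      ∀ j ∈ J, j ∈ S := fun S hS h j hj => by
    have : closure (Set.range P) ⊆ S := closure_minimal (by rintro _ ⟨a, rfl⟩; exact h a) hS
    refine this ?_
    rw [← NonUnitalStarAlgHom.coe_range]
    exact hj
  have hE := NonUnitalStarSubalgebra.isClosed_idealizer hJ
  let h : (H →L[ℂ] H) × (K →L[ℂ] K) := (multiplierExtension π F, multiplierExtension ρ F)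
  have hh : h ∈ J.idealizer := by
    intro j hj
    refine ⟨hind ((fun k => h * k) ⁻¹' J) (hJ.preimage (continuous_const_mul h)) (fun a => ?_) j hj,
      hind ((fun k => k * h) ⁻¹' J) (hJ.preimage (continuous_mul_const h)) (fun a => ?_) j hj⟩
    · have : h * P a = P (F.fst a) :=
        Prod.ext (multiplierExtension_mul π F a) (multiplierExtension_mul ρ F a)
      rw [Set.mem_preimage, this]
      exact hPJ _
    · have : P a * h = P (F.snd a) :=
        Prod.ext (hπ.mul_multiplierExtension F a) (hρ.mul_multiplierExtension F a)
      rw [Set.mem_preimage, this]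
      exact hPJ _
  refine ⟨J.idealizer, inferInstance, (StarAlgHom.fst ℂ _ _).comp J.idealizer.subtype,
    (StarAlgHom.snd ℂ _ _).comp J.idealizer.subtype, ⟨h, hh⟩, rfl, rfl, fun hle => ?_,
    fun hle => ?_⟩
  · have hle' : ∀ j ∈ J, ‖j.2‖ ≤ ‖j.1‖ :=
      hind {j | ‖j.2‖ ≤ ‖j.1‖} (isClosed_le continuous_snd.norm continuous_fst.norm) hle
    refine (injective_iff_map_eq_zero _).2 fun e he => ?_
    have h1 : e.1.1 = 0 := he
    refine Subtype.ext (Prod.ext h1 (hρ.eq_zero_of_mul fun a => ?_))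
    have h2 := hle' _ (e.2 _ (hPJ a)).1
    rw [Prod.fst_mul, h1, zero_mul, norm_zero, norm_le_zero_iff] at h2
    exact h2
  · have hle' : ∀ j ∈ J, ‖j.1‖ ≤ ‖j.2‖ :=
      hind {j | ‖j.1‖ ≤ ‖j.2‖} (isClosed_le continuous_fst.norm continuous_snd.norm) hle
    refine (injective_iff_map_eq_zero _).2 fun e he => ?_
    have h1 : e.1.2 = 0 := he
    refine Subtype.ext (Prod.ext (hπ.eq_zero_of_mul fun a => ?_) h1)
    have h2 := hle' _ (e.2 _ (hPJ a)).1
    rw [Prod.snd_mul, h1, zero_mul, norm_zero, norm_le_zero_iff] at h2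
    exact h2

end Idealizer

namespace TopGroupoid

open scoped CompactlySupported ComplexConjugate

/-! ### Groupoid identities and the involution on `C_c(Ξ)` -/

section Algebra

variable {Ξ X : Type*} [TopologicalSpace Ξ] [TopologicalSpace X] (G : TopGroupoid Ξ X)

theorem inv_inv (ξ : Ξ) : G.inv (G.inv ξ) = ξ :=
  (G.mul_eq_unit ξ (G.inv ξ) (G.r_inv ξ).symm ((G.mul_inv ξ).trans (by rw [G.d_inv]))).symm

theorem mul_congr {a a' b b' : Ξ} (ha : a = a') (hb : b = b') (h : G.d a = G.r b) :
    G.mul a b h = G.mul a' b' (ha ▸ hb ▸ h) := by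
  subst ha hb; rfl

theorem divFiber_mul {x : X} (ξ η : G.Fiber x) :
    G.mul (G.divFiber ξ η) η.1 (G.d_divFiber ξ η) = ξ.1 := by
  have h := G.mul_assoc ξ.1 (G.inv η.1) η.1 (comp_inv ξ η) (G.d_inv η.1)
  refine h.trans ?_
  rw [G.mul_congr rfl ((G.inv_mul η.1).trans (by rw [η.2, ← ξ.2])), G.mul_unit]

theorem inv_divFiber {x : X} (ξ η : G.Fiber x) :
    G.inv (G.divFiber ξ η) = G.divFiber η ξ := by
  obtain ⟨η, rfl⟩ := η
  have h := G.divFiber_mulRight_right η ⟨G.divFiber ξ ⟨η, rfl⟩, G.d_divFiber _ _⟩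
  rw [← h]
  congr 1
  exact Subtype.ext (G.divFiber_mul ξ ⟨η, rfl⟩)

theorem divFiber_mulRight_mulRight (ξ : Ξ) (ζ η : G.Fiber (G.r ξ)) :
    G.divFiber (G.mulRight ξ ζ) (G.mulRight ξ η) = G.divFiber ζ η := by
  have h1 := G.mul_assoc (G.divFiber ζ η) η.1 ξ (G.d_divFiber ζ η) η.2
  rw [G.mul_congr (G.divFiber_mul ζ η) rfl] at h1
  have h2 := G.mul_inv_cancel_right (G.divFiber ζ η) (G.mul η.1 ξ η.2)
    ((G.d_divFiber ζ η).trans (G.r_mul _ _ _).symm) (by rw [G.d_mul, G.r_inv])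
  refine Eq.trans ?_ h2
  exact G.mul_congr h1 rfl _

theorem divFiber_unit (x : X) (η : G.Fiber x) :
    G.divFiber η ⟨G.unit x, G.d_unit x⟩ = η.1 := by
  have h := G.divFiber_mul η ⟨G.unit x, G.d_unit x⟩
  have hd : G.d (G.divFiber η ⟨G.unit x, G.d_unit x⟩) = x := by rw [G.d_divFiber, G.r_unit]
  rw [G.mul_congr rfl (b' := G.unit (G.d (G.divFiber η ⟨G.unit x, G.d_unit x⟩))) (by rw [hd]),
    G.mul_unit] at h
  exact h

variable {G}

theorem TwoCocycle.congr (ω : G.TwoCocycle) {a a' b b' : Ξ} (ha : a = a') (hb : b = b')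
    (h : G.d a = G.r b) :
    ω.toFun ⟨(a, b), h⟩ = ω.toFun ⟨(a', b'), ha ▸ hb ▸ h⟩ := by
  subst ha hb; rfl

theorem TwoCocycle.eq_one_of_eq_unit (ω : G.TwoCocycle) {a b : Ξ} (h : G.d a = G.r b)
    (ha : a = G.unit (G.r b)) : ω.toFun ⟨(a, b), h⟩ = 1 := by
  rw [ω.congr ha rfl]; exact ω.unit_left b

/-- `ω(ξη⁻¹, η) ω(ηξ⁻¹, ξ) = ω(ξη⁻¹, ηξ⁻¹)`. -/
theorem TwoCocycle.mul_divFiber (ω : G.TwoCocycle) {x : X} (ξ η : G.Fiber x)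
    (h : G.d (G.divFiber ξ η) = G.r (G.inv (G.divFiber ξ η))) :
    ω.toFun ⟨(G.divFiber η ξ, ξ.1), G.d_divFiber η ξ⟩ *
      ω.toFun ⟨(G.divFiber ξ η, η.1), G.d_divFiber ξ η⟩ =
      ω.toFun ⟨(G.divFiber ξ η, G.inv (G.divFiber ξ η)), h⟩ := by
  have hi := G.inv_divFiber ξ η
  have h₁ : G.d (G.divFiber ξ η) = G.r (G.divFiber η ξ) := hi ▸ h
  have h2 := ω.cocycle (G.divFiber ξ η) (G.divFiber η ξ) ξ.1 h₁ (G.d_divFiber η ξ)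
  rw [ω.congr rfl hi, ω.congr rfl (G.divFiber_mul η ξ).symm, ← h2,
    ω.eq_one_of_eq_unit (a := G.mul _ _ _) _ ?_, mul_one]
  rw [G.mul_congr rfl hi.symm, G.mul_inv]
  exact congrArg G.unit (G.r_mul _ _ _)

/-- The involution `f*(ξ) = conj (f(ξ⁻¹)) conj (ω(ξ, ξ⁻¹))` of the twisted convolution algebra. -/
noncomputable def involution (ω : G.TwoCocycle) (f : C_c(Ξ, ℂ)) : C_c(Ξ, ℂ) where
  toFun ξ := conj (f (G.inv ξ)) * conj (ω.toFun ⟨(ξ, G.inv ξ), (G.r_inv ξ).symm⟩ : ℂ)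
  continuous_toFun := by
    refine (Complex.continuous_conj.comp (f.continuous.comp G.continuous_inv)).mul
      (Complex.continuous_conj.comp (continuous_subtype_val.comp (ω.continuous_toFun.comp ?_)))
    exact (continuous_id.prodMk G.continuous_inv).subtype_mk _
  hasCompactSupport' := by
    let e : Ξ ≃ₜ Ξ := ⟨⟨G.inv, G.inv, G.inv_inv, G.inv_inv⟩, G.continuous_inv, G.continuous_inv⟩
    exact ((f.hasCompactSupport.comp_homeomorph e).comp_left (g := conj) (map_zero _)).mul_right

theorem kernel_mk (ω : G.TwoCocycle) (f : C_c(Ξ, ℂ)) {x : X} (ξ η : G.Fiber x) :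
    kernel ω f x (ξ, η) =
      f (G.divFiber ξ η) * (ω.toFun ⟨(G.divFiber ξ η, η.1), G.d_divFiber ξ η⟩ : ℂ) := rfl

theorem involution_apply (ω : G.TwoCocycle) (f : C_c(Ξ, ℂ)) (ξ : Ξ) :
    involution ω f ξ =
      conj (f (G.inv ξ)) * conj (ω.toFun ⟨(ξ, G.inv ξ), (G.r_inv ξ).symm⟩ : ℂ) := rfl

theorem conj_circle_mul_self (z : Circle) : conj (z : ℂ) * (z : ℂ) = 1 := by
  rw [← Complex.normSq_eq_conj_mul_self, Circle.normSq_coe, Complex.ofReal_one]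

theorem kernel_involution (ω : G.TwoCocycle) (f : C_c(Ξ, ℂ)) {x : X} (ξ η : G.Fiber x) :
    kernel ω (involution ω f) x (ξ, η) = conj (kernel ω f x (η, ξ)) := by
  have h1 := congrArg (fun z : Circle => conj (z : ℂ)) (ω.mul_divFiber ξ η (G.r_inv _).symm)
  simp only [Circle.coe_mul, map_mul] at h1
  rw [kernel_mk, kernel_mk, involution_apply, ← h1, G.inv_divFiber, map_mul]
  linear_combination conj (f (G.divFiber η ξ)) *
    conj (ω.toFun ⟨(G.divFiber η ξ, ξ.1), G.d_divFiber η ξ⟩ : ℂ) *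
    conj_circle_mul_self (ω.toFun ⟨(G.divFiber ξ η, η.1), G.d_divFiber ξ η⟩)

/-- `ω(ζη⁻¹, ηξ) ω(η, ξ) = ω(ζη⁻¹, η) ω(ζ, ξ)`, in the form used for right translations. -/
theorem conj_mul_kernel_mulRight (ω : G.TwoCocycle) (f : C_c(Ξ, ℂ)) (ξ : Ξ)
    (ζ η : G.Fiber (G.r ξ)) :
    conj (ω.toFun ⟨(ζ.1, ξ), ζ.2⟩ : ℂ) *
        kernel ω f (G.d ξ) (G.mulRight ξ ζ, G.mulRight ξ η) =
      kernel ω f (G.r ξ) (ζ, η) * conj (ω.toFun ⟨(η.1, ξ), η.2⟩ : ℂ) := by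
  have h := ω.cocycle (G.divFiber ζ η) η.1 ξ (G.d_divFiber ζ η) η.2
  rw [ω.congr (G.divFiber_mul ζ η) rfl] at h
  have h' := congrArg (Subtype.val : Circle → ℂ) h
  simp only [Circle.coe_mul] at h'
  have hk : kernel ω f (G.d ξ) (G.mulRight ξ ζ, G.mulRight ξ η) = f (G.divFiber ζ η) *
      (ω.toFun ⟨(G.divFiber ζ η, G.mul η.1 ξ η.2),
        (G.d_divFiber ζ η).trans (G.r_mul _ _ _).symm⟩ : ℂ) := by
    have e := ω.congr (G.divFiber_mulRight_mulRight ξ ζ η) rfl (G.d_divFiber _ (G.mulRight ξ η))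
    exact congrArg₂ (fun (a : Ξ) (z : Circle) => f a * (z : ℂ))
      (G.divFiber_mulRight_mulRight ξ ζ η) e
  rw [hk, kernel_mk]
  have e1 := conj_circle_mul_self (ω.toFun ⟨(ζ.1, ξ), ζ.2⟩)
  have e2 := conj_circle_mul_self (ω.toFun ⟨(η.1, ξ), η.2⟩)
  generalize (ω.toFun ⟨(ζ.1, ξ), ζ.2⟩ : ℂ) = z1 at *
  generalize (ω.toFun ⟨(η.1, ξ), η.2⟩ : ℂ) = z2 at *
  generalize (ω.toFun ⟨(G.divFiber ζ η, G.mul η.1 ξ η.2), _⟩ : ℂ) = w1 at *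
  generalize (ω.toFun ⟨(G.divFiber ζ η, η.1), _⟩ : ℂ) = w2 at *
  linear_combination f (G.divFiber ζ η) * (w2 * conj z2 * e1 - conj z1 * w1 * e2
    - conj z1 * conj z2 * h')

end Algebra

end TopGroupoid

/-! ### Compactly supported functions and unimodular multiplications -/

open scoped CompactlySupported in
/-- A version of the Tietze extension theorem for compactly supported functions. -/
theorem exists_compactlySupported_extension {Y Z : Type*} [TopologicalSpace Y] [TopologicalSpace Z]
    [T2Space Z] [LocallyCompactSpace Z] [NormalSpace Z] {e : Y → Z} (he : IsClosedEmbedding e)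
    {g : Y → ℂ} (hg : Continuous g) (hgc : HasCompactSupport g) :
    ∃ φ : C_c(Z, ℂ), ∀ y, φ (e y) = g y := by
  obtain ⟨G, hG⟩ := ContinuousMap.exists_extension' he ⟨g, hg⟩
  obtain ⟨χ, h1, -, h3, -⟩ := exists_continuous_one_zero_of_isCompact
    (hgc.isCompact.image he.continuous) isClosed_empty (Set.disjoint_empty _)
  refine ⟨⟨⟨fun z => (χ z : ℂ) * G z,
    (Complex.continuous_ofReal.comp χ.continuous).mul G.continuous⟩,
    (h3.comp_left (g := ((↑) : ℝ → ℂ)) Complex.ofReal_zero).mul_right⟩, fun y => ?_⟩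
  have hy : G (e y) = g y := congrFun hG y
  change (χ (e y) : ℂ) * G (e y) = g y
  rw [hy]
  by_cases h : y ∈ tsupport g
  · rw [h1 (Set.mem_image_of_mem e h)]
    simp
  · rw [image_eq_zero_of_notMem_tsupport h, mul_zero]

theorem memLp_unimodular_mul {Y : Type*} [MeasurableSpace Y] {ν : Measure Y} {c : Y → ℂ}
    (hc : Measurable c) (h1 : ∀ y, ‖c y‖ = 1) (u : Lp ℂ 2 ν) : MemLp (fun y => c y * u y) 2 ν :=
  (Lp.memLp u).congr_norm (hc.aestronglyMeasurable.mul (Lp.aestronglyMeasurable u))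
    (Eventually.of_forall fun y => by rw [norm_mul, h1, one_mul])

/-- Multiplication by a measurable function with values in the unit circle, on `L²`. -/
noncomputable def unimodularMul {Y : Type*} [MeasurableSpace Y] {ν : Measure Y} (c : Y → ℂ)
    (hc : Measurable c) (h1 : ∀ y, ‖c y‖ = 1) : Lp ℂ 2 ν →ₗᵢ[ℂ] Lp ℂ 2 ν :=
  { toFun := fun u => (memLp_unimodular_mul hc h1 u).toLp _
    map_add' := fun u w => by
      rw [← MemLp.toLp_add]
      refine MemLp.toLp_congr _ _ ?_
      filter_upwards [Lp.coeFn_add u w] with y hy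
      rw [hy, Pi.add_apply, Pi.add_apply, mul_add]
    map_smul' := fun z u => by
      rw [RingHom.id_apply, ← MemLp.toLp_const_smul]
      refine MemLp.toLp_congr _ _ ?_
      filter_upwards [Lp.coeFn_smul z u] with y hy
      rw [hy, Pi.smul_apply, Pi.smul_apply, smul_eq_mul, smul_eq_mul, mul_left_comm]
    norm_map' := fun u => by
      change ‖(memLp_unimodular_mul hc h1 u).toLp _‖ = _
      rw [Lp.norm_toLp, Lp.norm_def]
      congr 1
      refine eLpNorm_congr_norm_ae (Eventually.of_forall fun y => ?_)
      rw [norm_mul, h1, one_mul] }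

theorem unimodularMul_apply {Y : Type*} [MeasurableSpace Y] {ν : Measure Y} (c : Y → ℂ)
    (hc : Measurable c) (h1 : ∀ y, ‖c y‖ = 1) (u : Lp ℂ 2 ν) :
    unimodularMul c hc h1 u =ᵐ[ν] fun y => c y * u y :=
  MemLp.coeFn_toLp (memLp_unimodular_mul hc h1 u)

namespace TopGroupoid

open scoped CompactlySupported ComplexConjugate

variable {Ξ : Type u} {X : Type v} [TopologicalSpace Ξ] [TopologicalSpace X]
  {G : TopGroupoid Ξ X}

/-! ### Kernels and functions on the fibres -/

theorem continuous_fiber (φ : C_c(Ξ, ℂ)) (x : X) : Continuous fun η : G.Fiber x => φ η.1 :=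
  φ.continuous.comp continuous_subtype_val

theorem hasCompactSupport_fiber [T2Space Ξ] (φ : C_c(Ξ, ℂ)) (x : X) :
    HasCompactSupport fun η : G.Fiber x => φ η.1 :=
  φ.hasCompactSupport.comp_isClosedEmbedding (G.isClosedEmbedding_fiber x)

/-- The kernels of `Π_x(f)`, `x ∈ X`, are the restrictions of one continuous function. -/
theorem exists_kernel_extension [T2Space Ξ] [LocallyCompactSpace Ξ] [SigmaCompactSpace Ξ]
    (ω : G.TwoCocycle) (f : C_c(Ξ, ℂ)) :
    ∃ K : C(Ξ × Ξ, ℂ), ∀ x (ξ η : G.Fiber x), K (ξ.1, η.1) = kernel ω f x (ξ, η) := by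
  have := G.t2Space_units
  let D : Set (Ξ × Ξ) := {p | G.d p.1 = G.d p.2}
  have hD : IsClosed D := isClosed_eq (G.continuous_d.comp continuous_fst)
    (G.continuous_d.comp continuous_snd)
  have hc : ∀ p : D, G.d p.1.1 = G.r (G.inv p.1.2) := fun p => p.2.trans (G.r_inv _).symm
  have hdiv : Continuous fun p : D => G.mul p.1.1 (G.inv p.1.2) (hc p) := by
    have h : Continuous fun p : D =>
        (⟨(p.1.1, G.inv p.1.2), hc p⟩ : {p : Ξ × Ξ // G.d p.1 = G.r p.2}) :=
      ((continuous_fst.comp continuous_subtype_val).prodMk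
        (G.continuous_inv.comp (continuous_snd.comp continuous_subtype_val))).subtype_mk _
    exact G.continuous_mul.comp h
  have hd : ∀ p : D, G.d (G.mul p.1.1 (G.inv p.1.2) (hc p)) = G.r p.1.2 := fun p =>
    (G.d_mul _ _ _).trans (G.d_inv _)
  let k : C(D, ℂ) := ⟨fun p => f (G.mul p.1.1 (G.inv p.1.2) (hc p)) *
    (ω.toFun ⟨(G.mul p.1.1 (G.inv p.1.2) (hc p), p.1.2), hd p⟩ : ℂ), by
      refine (f.continuous.comp hdiv).mul
        (continuous_subtype_val.comp (ω.continuous_toFun.comp ?_))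
      exact (hdiv.prodMk (continuous_snd.comp continuous_subtype_val)).subtype_mk _⟩
  obtain ⟨K, hK⟩ := ContinuousMap.exists_restrict_eq hD k
  exact ⟨K, fun x ξ η => DFunLike.congr_fun hK ⟨(ξ.1, η.1), ξ.2.trans η.2.symm⟩⟩

variable [MeasurableSpace Ξ]

theorem twistedConv_ne_zero (μ : G.HaarSystem) (ω : G.TwoCocycle) (f φ : C_c(Ξ, ℂ)) {x : X}
    {ξ : G.Fiber x} (h : twistedConv μ ω f (fun η : G.Fiber x => φ η.1) ξ ≠ 0) :
    ∃ η : G.Fiber x, f (G.divFiber ξ η) ≠ 0 ∧ φ η.1 ≠ 0 := by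
  by_contra! hcon
  refine h ?_
  have : ∀ η : G.Fiber x, kernel ω f x (ξ, η) * φ η.1 = 0 := fun η => by
    by_cases hf : f (G.divFiber ξ η) = 0
    · rw [kernel_mk, hf, zero_mul, zero_mul]
    · rw [hcon η hf, mul_zero]
  simp only [twistedConv, this, integral_zero]

instance HaarSystem.instRegular (μ : G.HaarSystem) (x : X) : (μ.measure x).Regular := μ.regular x

instance HaarSystem.instIsOpenPosMeasure (μ : G.HaarSystem) (x : X) :
    (μ.measure x).IsOpenPosMeasure := μ.isOpenPosMeasure x

variable [T2Space Ξ] [BorelSpace Ξ]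

/-! ### Integrals over the fibres depending on a parameter -/

/-- Continuity of an integral against the Haar system in both the parameter and the fibre. -/
theorem continuous_integral_kernel (μ : G.HaarSystem) (K : C(Ξ × Ξ, ℂ)) (φ : C_c(Ξ, ℂ)) :
    Continuous fun p : Ξ × X => ∫ η : G.Fiber p.2, K (p.1, η.1) * φ η.1 ∂(μ.measure p.2) := by
  obtain ⟨C, hC⟩ := exists_lintegral_bound μ φ
  have hint : ∀ (k : C(Ξ, ℂ)) x,
      Integrable (fun η : G.Fiber x => k η.1 * φ η.1) (μ.measure x) := fun k x =>
    ((k.continuous.comp continuous_subtype_val).mul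
      (continuous_fiber φ x)).integrable_of_hasCompactSupport (hasCompactSupport_fiber φ x).mul_left
  refine continuous_iff_continuousAt.2 fun ⟨ξ₀, x₀⟩ => ?_
  -- the integrals at `ξ₀` depend continuously on `x` by the axioms of a Haar system
  let ψ : C_c(Ξ, ℂ) := ⟨⟨fun η => K (ξ₀, η) * φ η,
    (K.continuous.comp (Continuous.prodMk_right ξ₀)).mul φ.continuous⟩,
    φ.hasCompactSupport.mul_left⟩
  have h1 : Tendsto (fun p : Ξ × X => ∫ η : G.Fiber p.2, K (ξ₀, η.1) * φ η.1 ∂(μ.measure p.2))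
      (𝓝 (ξ₀, x₀)) (𝓝 (∫ η : G.Fiber x₀, K (ξ₀, η.1) * φ η.1 ∂(μ.measure x₀))) :=
    ((μ.continuous_integral ψ).comp continuous_snd).tendsto (ξ₀, x₀)
  -- and `K(ξ, ·)` is uniformly close to `K(ξ₀, ·)` on the support of `φ`
  refine Metric.tendsto_nhds.2 fun ε hε => ?_
  set δ : ℝ := ε / (2 * (C + 1)) with hδ
  have hδ0 : 0 < δ := by positivity
  have h2 : ∀ᶠ ξ in 𝓝 ξ₀, ∀ η ∈ tsupport φ, ‖K (ξ, η) - K (ξ₀, η)‖ < δ := by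
    refine φ.hasCompactSupport.isCompact.eventually_forall_of_forall_eventually fun η _ => ?_
    have hc : Continuous fun z : Ξ × Ξ => ‖K (z.1, z.2) - K (ξ₀, z.2)‖ :=
      ((K.continuous.comp (continuous_fst.prodMk continuous_snd)).sub
        (K.continuous.comp (continuous_const.prodMk continuous_snd))).norm
    refine (hc.tendsto (ξ₀, η)).eventually_lt_const ?_
    simpa using hδ0
  have h3 : ∀ᶠ p : Ξ × X in 𝓝 (ξ₀, x₀), ∀ η ∈ tsupport φ, ‖K (p.1, η) - K (ξ₀, η)‖ < δ :=
    (continuous_fst.tendsto (ξ₀, x₀)).eventually h2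
  filter_upwards [h3, Metric.tendsto_nhds.1 h1 (ε / 2) (half_pos hε)] with p hp hp2
  have h4 : dist (∫ η : G.Fiber p.2, K (p.1, η.1) * φ η.1 ∂(μ.measure p.2))
      (∫ η : G.Fiber p.2, K (ξ₀, η.1) * φ η.1 ∂(μ.measure p.2)) ≤ δ * C := by
    have i1 := hint (K.comp ⟨_, Continuous.prodMk_right p.1⟩) p.2
    have i2 := hint (K.comp ⟨_, Continuous.prodMk_right ξ₀⟩) p.2
    have iφ : Integrable (fun η : G.Fiber p.2 => φ η.1) (μ.measure p.2) := by
      simpa using hint 1 p.2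
    rw [dist_eq_norm]
    refine (congrArg norm (integral_sub i1 i2)).symm.trans_le ?_
    calc _ ≤ ∫ η : G.Fiber p.2, δ * ‖φ η.1‖ ∂(μ.measure p.2) := by
          refine norm_integral_le_of_norm_le (iφ.norm.const_mul δ)
            (Eventually.of_forall fun η => ?_)
          change ‖K (p.1, η.1) * φ η.1 - K (ξ₀, η.1) * φ η.1‖ ≤ _
          rw [← sub_mul, norm_mul]
          by_cases hη : η.1 ∈ tsupport φ
          · gcongr
            exact (hp _ hη).le
          · rw [image_eq_zero_of_notMem_tsupport hη]
            simp
      _ = δ * ∫ η : G.Fiber p.2, ‖φ η.1‖ ∂(μ.measure p.2) := integral_const_mul _ _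
      _ ≤ δ * C := by
          gcongr
          rw [integral_norm_eq_lintegral_enorm iφ.aestronglyMeasurable]
          exact ENNReal.toReal_le_of_le_ofReal C.2 (by simpa using hC p.2)
  have h5 : δ * C ≤ ε / 2 := by
    rw [hδ, div_mul_eq_mul_div, div_le_div_iff₀ (by positivity) two_pos]
    nlinarith [C.2]
  linarith [dist_triangle (∫ η : G.Fiber p.2, K (p.1, η.1) * φ η.1 ∂(μ.measure p.2))
    (∫ η : G.Fiber p.2, K (ξ₀, η.1) * φ η.1 ∂(μ.measure p.2))
    (∫ η : G.Fiber x₀, K (ξ₀, η.1) * φ η.1 ∂(μ.measure x₀))]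

/-! ### The dense sections of the field of Hilbert spaces `L²(Ξ_x; λ_x)` -/

theorem memLp_fiber (μ : G.HaarSystem) (φ : C_c(Ξ, ℂ)) (x : X) :
    MemLp (fun η : G.Fiber x => φ η.1) 2 (μ.measure x) :=
  (continuous_fiber φ x).memLp_of_hasCompactSupport (hasCompactSupport_fiber φ x)

/-- The restriction of `φ ∈ C_c(Ξ)` to the fibre `Ξ_x`, as an element of `L²(Ξ_x; λ_x)`. -/
noncomputable def restrictL2 (μ : G.HaarSystem) (φ : C_c(Ξ, ℂ)) (x : X) : μ.L2 x :=
  (memLp_fiber μ φ x).toLp _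

theorem coeFn_restrictL2 (μ : G.HaarSystem) (φ : C_c(Ξ, ℂ)) (x : X) :
    restrictL2 μ φ x =ᵐ[μ.measure x] fun η => φ η.1 :=
  MemLp.coeFn_toLp _

theorem continuous_norm_restrictL2 (μ : G.HaarSystem) (φ : C_c(Ξ, ℂ)) :
    Continuous fun x => ‖restrictL2 μ φ x‖ := by
  have h : Continuous fun x => ∫ η : G.Fiber x, (star φ * φ) η.1 ∂(μ.measure x) :=
    μ.continuous_integral (star φ * φ)
  have h2 : ∀ x, ‖restrictL2 μ φ x‖ =
      √(∫ η : G.Fiber x, (star φ * φ) η.1 ∂(μ.measure x)).re := fun x => by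
    rw [norm_eq_sqrt_re_inner (𝕜 := ℂ) (restrictL2 μ φ x), L2.inner_def]
    refine congrArg (fun z : ℂ => √z.re) (integral_congr_ae ?_)
    filter_upwards [coeFn_restrictL2 μ φ x] with η hη
    rw [hη, RCLike.inner_apply, mul_comm]
    rfl
  simp only [h2]
  exact (Complex.continuous_re.comp h).sqrt

variable [LocallyCompactSpace Ξ] [SigmaCompactSpace Ξ]

theorem denseRange_restrictL2 (μ : G.HaarSystem) (x : X) :
    DenseRange fun φ => restrictL2 μ φ x := by
  have hx := G.isClosedEmbedding_fiber x
  have : LocallyCompactSpace (G.Fiber x) := hx.locallyCompactSpace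
  have : NormalSpace (G.Fiber x) := hx.normalSpace
  refine Metric.denseRange_iff.2 fun u ε hε => ?_
  obtain ⟨g, hgc, hg, hgcont, hgm⟩ := (Lp.memLp u).exists_hasCompactSupport_eLpNorm_sub_le
    ENNReal.ofNat_ne_top (ε := ENNReal.ofReal (ε / 2)) (by simpa using hε)
  obtain ⟨φ, hφ⟩ := exists_compactlySupported_extension hx hgcont hgc
  refine ⟨φ, ?_⟩
  have h1 : u = (Lp.memLp u).toLp _ := (Lp.toLp_coeFn _ _).symm
  rw [dist_eq_norm, h1, restrictL2, ← MemLp.toLp_sub, Lp.norm_toLp]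
  have h2 : (fun η : G.Fiber x => φ η.1) = g := funext hφ
  rw [h2]
  refine (ENNReal.toReal_le_of_le_ofReal (by positivity) hg).trans_lt (half_lt_self hε)

/-! ### Twisted convolution of compactly supported functions -/

/-- The twisted convolution `f ⋆_ω φ` of functions in `C_c(Ξ)`. -/
noncomputable def conv (μ : G.HaarSystem) (ω : G.TwoCocycle) (f φ : C_c(Ξ, ℂ)) : C_c(Ξ, ℂ) where
  toFun ξ := twistedConv μ ω f (fun η : G.Fiber (G.d ξ) => φ η.1) ⟨ξ, rfl⟩
  continuous_toFun := by
    obtain ⟨K, hK⟩ := exists_kernel_extension ω f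
    have h := (continuous_integral_kernel μ K φ).comp (continuous_id.prodMk G.continuous_d)
    refine h.congr fun ξ => ?_
    simp only [Function.comp_apply, id, twistedConv]
    congr 1
    funext η
    rw [← hK]
  hasCompactSupport' := by
    have := G.t2Space_units
    have hcl : IsClosed {p : Ξ × Ξ | G.d p.1 = G.r p.2} := isClosed_eq
      (G.continuous_d.comp continuous_fst) (G.continuous_r.comp continuous_snd)
    have hk := hcl.isClosedEmbedding_subtypeVal.isCompact_preimage
      (f.hasCompactSupport.isCompact.prod φ.hasCompactSupport.isCompact)
    refine HasCompactSupport.intro (hk.image G.continuous_mul) fun ξ hξ => ?_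
    by_contra h
    obtain ⟨η, hf, hφ⟩ := twistedConv_ne_zero μ ω f φ h
    refine hξ ⟨⟨(G.divFiber ⟨ξ, rfl⟩ η, η.1), G.d_divFiber _ _⟩,
      ⟨subset_tsupport _ hf, subset_tsupport _ hφ⟩, ?_⟩
    exact G.divFiber_mul ⟨ξ, rfl⟩ η

theorem conv_apply (μ : G.HaarSystem) (ω : G.TwoCocycle) (f φ : C_c(Ξ, ℂ)) {x : X}
    (ξ : G.Fiber x) :
    conv μ ω f φ ξ.1 = twistedConv μ ω f (fun η : G.Fiber x => φ η.1) ξ := by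
  obtain ⟨ξ, rfl⟩ := ξ
  rfl

theorem regularRep_restrictL2 (μ : G.HaarSystem) (ω : G.TwoCocycle) (f φ : C_c(Ξ, ℂ)) (x : X) :
    regularRep μ ω f x (restrictL2 μ φ x) = restrictL2 μ (conv μ ω f φ) x := by
  refine Lp.ext ?_
  filter_upwards [regularRep_apply μ ω f x (restrictL2 μ φ x), coeFn_restrictL2 μ (conv μ ω f φ) x]
    with ξ h1 h2
  rw [h1, h2, conv_apply]
  refine integral_congr_ae ?_
  filter_upwards [coeFn_restrictL2 μ φ x] with η hη
  rw [hη]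

end TopGroupoid

namespace TopGroupoid

open scoped CompactlySupported ComplexConjugate

variable {Ξ : Type u} {X : Type v} [TopologicalSpace Ξ] [TopologicalSpace X]
  {G : TopGroupoid Ξ X}

/-! ### Bounded families, translations, and convolution with `L²` functions -/

theorem mem_orbitClosure_self (G : TopGroupoid Ξ X) (x : X) : x ∈ G.orbitClosure x :=
  subset_closure ⟨G.unit x, G.d_unit x, G.r_unit x⟩

variable [MeasurableSpace Ξ]

theorem HaarSystem.BoundedField.norm_component_le {μ : G.HaarSystem} (T : μ.BoundedField) (x : X) :
    ‖T.component x‖ ≤ ‖T‖ :=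
  lp.norm_apply_le_norm (E := fun x : X => μ.L2 x →L[ℂ] μ.L2 x) ENNReal.top_ne_zero T x

variable [BorelSpace Ξ]

theorem measurable_conj_cocycle (ω : G.TwoCocycle) (ξ : Ξ) :
    Measurable fun ζ : G.Fiber (G.r ξ) => conj (ω.toFun ⟨(ζ.1, ξ), ζ.2⟩ : ℂ) := by
  refine (Complex.continuous_conj.comp
    (continuous_subtype_val.comp (ω.continuous_toFun.comp ?_))).measurable
  exact (continuous_subtype_val.prodMk continuous_const).subtype_mk _

theorem HaarSystem.measurePreserving_mulRight (μ : G.HaarSystem) (ξ : Ξ) :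
    MeasurePreserving (G.mulRight ξ) (μ.measure (G.r ξ)) (μ.measure (G.d ξ)) :=
  ⟨(G.continuous_mulRight ξ).measurable, μ.map_mulRight ξ⟩

/-- The isometry `(U_ξ u)(ζ) = conj (ω(ζ, ξ)) u(ζξ)` from `L²(Ξ_{d(ξ)})` to `L²(Ξ_{r(ξ)})`. -/
noncomputable def translation (μ : G.HaarSystem) (ω : G.TwoCocycle) (ξ : Ξ) :
    μ.L2 (G.d ξ) →ₗᵢ[ℂ] μ.L2 (G.r ξ) :=
  (unimodularMul (fun ζ : G.Fiber (G.r ξ) => conj (ω.toFun ⟨(ζ.1, ξ), ζ.2⟩ : ℂ))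
    (measurable_conj_cocycle ω ξ) (fun ζ => by rw [RCLike.norm_conj, Circle.norm_coe])).comp
    (Lp.compMeasurePreservingₗᵢ ℂ (G.mulRight ξ) (μ.measurePreserving_mulRight ξ))

theorem translation_apply (μ : G.HaarSystem) (ω : G.TwoCocycle) (ξ : Ξ) (u : μ.L2 (G.d ξ)) :
    translation μ ω ξ u =ᵐ[μ.measure (G.r ξ)]
      fun ζ => conj (ω.toFun ⟨(ζ.1, ξ), ζ.2⟩ : ℂ) * u (G.mulRight ξ ζ) := by
  have h1 := Lp.coeFn_compMeasurePreserving u (μ.measurePreserving_mulRight ξ)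
  have h2 := unimodularMul_apply (ν := μ.measure (G.r ξ))
    (fun ζ : G.Fiber (G.r ξ) => conj (ω.toFun ⟨(ζ.1, ξ), ζ.2⟩ : ℂ))
    (measurable_conj_cocycle ω ξ) (fun ζ => by rw [RCLike.norm_conj, Circle.norm_coe])
    (Lp.compMeasurePreserving (G.mulRight ξ) (μ.measurePreserving_mulRight ξ) u)
  filter_upwards [h1, h2] with ζ h1 h2
  refine h2.trans ?_
  rw [h1]
  rfl

variable [T2Space Ξ] [LocallyCompactSpace Ξ]

/-- If `w ∈ L²(Ξ_x)`, then `f ⋆_ω w` is continuous near the unit of `Ξ_x`. -/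
theorem continuousAt_twistedConv_unit (μ : G.HaarSystem) (ω : G.TwoCocycle) (f : C_c(Ξ, ℂ)) (x : X)
    (w : μ.L2 x) : ContinuousAt (twistedConv μ ω f w) ⟨G.unit x, G.d_unit x⟩ := by
  have hx := G.isClosedEmbedding_fiber x
  have := G.t2Space_units
  have : LocallyCompactSpace (G.Fiber x) := hx.locallyCompactSpace
  obtain ⟨N, hN, hNx⟩ := exists_compact_mem_nhds (⟨G.unit x, G.d_unit x⟩ : G.Fiber x)
  -- for `ξ ∈ N`, the kernel is supported in the compact set `(supp f)⁻¹ N`, since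
  -- `η = (ξη⁻¹)⁻¹ξ`
  have hcl : IsClosed {p : Ξ × Ξ | G.d p.1 = G.r p.2} := isClosed_eq
    (G.continuous_d.comp continuous_fst) (G.continuous_r.comp continuous_snd)
  have hk₀ := (hcl.isClosedEmbedding_subtypeVal.isCompact_preimage
    ((f.hasCompactSupport.isCompact.image G.continuous_inv).prod
      (hN.image continuous_subtype_val))).image G.continuous_mul
  have hk := hx.isCompact_preimage hk₀
  have hcont := continuousOn_integral_bilinear_of_locally_integrable_of_compact_support
    (μ := μ.measure x) (s := N) (g := w) (f := fun ξ η => kernel ω f x (ξ, η))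
    (ContinuousLinearMap.mul ℝ ℂ).flip hk (continuous_kernel ω f x).continuousOn
    (fun ξ η hξ hη => ?_) ?_
  · exact hcont.continuousAt hNx
  · by_contra hne
    refine hη ⟨⟨(G.divFiber η ξ, ξ.1), G.d_divFiber η ξ⟩, ⟨?_, Set.mem_image_of_mem _ hξ⟩,
      G.divFiber_mul η ξ⟩
    rw [kernel_mk] at hne
    exact ⟨_, subset_tsupport _ (left_ne_zero_of_mul hne), G.inv_divFiber ξ η⟩
  · have : IsFiniteMeasure ((μ.measure x).restrict _) := ⟨by
      rw [Measure.restrict_apply_univ]; exact hk.measure_lt_top⟩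
    exact ((Lp.memLp w).restrict _).integrable one_le_two

variable [SigmaCompactSpace Ξ]

/-! ### Adjoints of the regular representations -/

theorem star_regularRep (μ : G.HaarSystem) (ω : G.TwoCocycle) (f : C_c(Ξ, ℂ)) (x : X) :
    star (regularRep μ ω f x) = regularRep μ ω (involution ω f) x := by
  rw [ContinuousLinearMap.star_eq_adjoint, eq_comm, ContinuousLinearMap.eq_adjoint_iff]
  -- it suffices to compare matrix coefficients of restrictions of functions in `C_c(Ξ)`
  intro u v
  refine (denseRange_restrictL2 μ x).induction_on₂ (p := fun u v : μ.L2 x =>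
    inner ℂ (regularRep μ ω (involution ω f) x u) v = inner ℂ u (regularRep μ ω f x v))
    ?_ ?_ u v
  · exact isClosed_eq (((regularRep μ ω (involution ω f) x).continuous.comp continuous_fst).inner
      continuous_snd) (continuous_fst.inner ((regularRep μ ω f x).continuous.comp continuous_snd))
  · intro φ ψ
    let F : G.Fiber x → G.Fiber x → ℂ := fun ξ η =>
      kernel ω f x (η, ξ) * ψ ξ.1 * conj (φ η.1)
    have hF : Continuous F.uncurry :=
      (((continuous_kernel ω f x).comp continuous_swap).mul
        ((continuous_fiber ψ x).comp continuous_fst)).mul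
        (Complex.continuous_conj.comp ((continuous_fiber φ x).comp continuous_snd))
    have hF' : HasCompactSupport F.uncurry := by
      refine HasCompactSupport.intro ((hasCompactSupport_fiber ψ x).isCompact.prod
        (hasCompactSupport_fiber φ x).isCompact) fun p hp => ?_
      rw [Set.mem_prod, not_and_or] at hp
      change kernel ω f x (p.2, p.1) * ψ p.1.1 * conj (φ p.2.1) = 0
      rcases hp with hp | hp
      · have h0 : ψ p.1.1 = 0 :=
          image_eq_zero_of_notMem_tsupport (f := fun η : G.Fiber x => ψ η.1) hp
        rw [h0, mul_zero, zero_mul]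
      · have h0 : φ p.2.1 = 0 :=
          image_eq_zero_of_notMem_tsupport (f := fun η : G.Fiber x => φ η.1) hp
        rw [h0, map_zero, mul_zero]
    have hl : inner ℂ (regularRep μ ω (involution ω f) x (restrictL2 μ φ x)) (restrictL2 μ ψ x) =
        ∫ ξ, ∫ η, F ξ η ∂(μ.measure x) ∂(μ.measure x) := by
      rw [regularRep_restrictL2, L2.inner_def]
      refine integral_congr_ae ?_
      filter_upwards [coeFn_restrictL2 μ (conv μ ω (involution ω f) φ) x, coeFn_restrictL2 μ ψ x]
        with ξ h1 h2
      rw [h1, h2, RCLike.inner_apply, conv_apply, twistedConv, ← integral_conj,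
        ← integral_const_mul]
      congr 1
      funext η
      rw [map_mul, kernel_involution, Complex.conj_conj]
      ring
    have hr : inner ℂ (restrictL2 μ φ x) (regularRep μ ω f x (restrictL2 μ ψ x)) =
        ∫ η, ∫ ξ, F ξ η ∂(μ.measure x) ∂(μ.measure x) := by
      rw [regularRep_restrictL2, L2.inner_def]
      refine integral_congr_ae ?_
      filter_upwards [coeFn_restrictL2 μ (conv μ ω f ψ) x, coeFn_restrictL2 μ φ x] with η h1 h2
      rw [h1, h2, RCLike.inner_apply, conv_apply, twistedConv, ← integral_mul_const]
    rw [hl, hr, integral_integral_swap_of_hasCompactSupport hF hF']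

theorem star_regularField (μ : G.HaarSystem) (ω : G.TwoCocycle) (f : C_c(Ξ, ℂ)) :
    star (regularField μ ω f) = regularField μ ω (involution ω f) :=
  Subtype.ext (funext fun x => star_regularRep μ ω f x)

/-- Since the operators `Π_x(f)` are closed under adjoints, the reduced algebra is the closure of
the algebra generated by them. -/
theorem adjoin_regularField_induction {μ : G.HaarSystem} {ω : G.TwoCocycle}
    {p : μ.BoundedField → Prop} (hgen : ∀ f, p (regularField μ ω f)) (hzero : p 0)
    (hadd : ∀ a b, p a → p b → p (a + b)) (hmul : ∀ a b, p a → p b → p (a * b))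
    (hsmul : ∀ (z : ℂ) a, p a → p (z • a)) {a : μ.BoundedField}
    (ha : a ∈ NonUnitalStarAlgebra.adjoin ℂ (Set.range (regularField μ ω))) : p a := by
  have ha' : a ∈ NonUnitalAlgebra.adjoin ℂ
      (Set.range (regularField μ ω) ∪ star (Set.range (regularField μ ω))) := ha
  refine NonUnitalAlgebra.adjoin_induction (p := fun a _ => p a) ?_ (fun a b _ _ => hadd a b) hzero
    (fun a b _ _ => hmul a b) (fun z a _ => hsmul z a) ha'
  rintro a (⟨f, rfl⟩ | ⟨f, hf⟩)
  · exact hgen f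
  · rw [← star_star a, ← hf, star_regularField]
    exact hgen _

theorem exists_adjoin_norm_sub_lt {μ : G.HaarSystem} {ω : G.TwoCocycle} {a : μ.BoundedField}
    (ha : a ∈ reducedAlgebra μ ω) {ε : ℝ} (hε : 0 < ε) :
    ∃ b ∈ NonUnitalStarAlgebra.adjoin ℂ (Set.range (regularField μ ω)), ‖a - b‖ < ε := by
  have ha' : a ∈ closure
      (NonUnitalStarAlgebra.adjoin ℂ (Set.range (regularField μ ω)) : Set μ.BoundedField) := ha
  obtain ⟨b, hb, h⟩ := Metric.mem_closure_iff.1 ha' ε hε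
  exact ⟨b, hb, by rwa [← dist_eq_norm]⟩

/-! ### Right translations intertwine the regular representations along an orbit -/

theorem translation_regularRep (μ : G.HaarSystem) (ω : G.TwoCocycle) (f : C_c(Ξ, ℂ)) (ξ : Ξ)
    (u : μ.L2 (G.d ξ)) :
    translation μ ω ξ (regularRep μ ω f (G.d ξ) u) =
      regularRep μ ω f (G.r ξ) (translation μ ω ξ u) := by
  have hR := μ.measurePreserving_mulRight ξ
  refine Lp.ext ?_
  filter_upwards [translation_apply μ ω ξ (regularRep μ ω f (G.d ξ) u),
    hR.quasiMeasurePreserving.ae (regularRep_apply μ ω f (G.d ξ) u),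
    regularRep_apply μ ω f (G.r ξ) (translation μ ω ξ u)] with ζ h1 h2 h3
  have hk : Measurable fun η => kernel ω f (G.d ξ) (G.mulRight ξ ζ, η) :=
    ((continuous_kernel ω f (G.d ξ)).comp (Continuous.prodMk_right _)).measurable
  have hm : AEStronglyMeasurable
      (fun η => kernel ω f (G.d ξ) (G.mulRight ξ ζ, η) * u η)
      ((μ.measure (G.r ξ)).map (G.mulRight ξ)) := by
    rw [hR.map_eq]
    exact hk.aestronglyMeasurable.mul (Lp.aestronglyMeasurable u)
  have hi := integral_map hR.measurable.aemeasurable hm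
  rw [hR.map_eq] at hi
  rw [h1, h2, h3, twistedConv, twistedConv, hi, ← integral_const_mul]
  refine integral_congr_ae ?_
  filter_upwards [translation_apply μ ω ξ u] with η hη
  rw [hη, ← _root_.mul_assoc, conj_mul_kernel_mulRight, _root_.mul_assoc]

theorem translation_component {μ : G.HaarSystem} {ω : G.TwoCocycle} {a : μ.BoundedField}
    (ha : a ∈ reducedAlgebra μ ω) (ξ : Ξ) (u : μ.L2 (G.d ξ)) :
    translation μ ω ξ (a.component (G.d ξ) u) = a.component (G.r ξ) (translation μ ω ξ u) := by
  have hb : ∀ b ∈ NonUnitalStarAlgebra.adjoin ℂ (Set.range (regularField μ ω)),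
      ∀ u, translation μ ω ξ (b.component (G.d ξ) u) =
        b.component (G.r ξ) (translation μ ω ξ u) := fun b hb => by
    refine adjoin_regularField_induction (p := fun b : μ.BoundedField =>
      ∀ u, translation μ ω ξ (b.component (G.d ξ) u) =
        b.component (G.r ξ) (translation μ ω ξ u)) (fun f u => translation_regularRep μ ω f ξ u)
      (fun u => map_zero _) (fun b c hb hc u => ?_) (fun b c hb hc u => ?_) (fun z b hb u => ?_) hb
    · exact (map_add (translation μ ω ξ) _ _).trans (congrArg₂ (· + ·) (hb u) (hc u))
    · exact (hb _).trans (congrArg (b.component (G.r ξ)) (hc u))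
    · exact (map_smul (translation μ ω ξ) z _).trans (congrArg (z • ·) (hb u))
  refine eq_of_forall_dist_le fun ε hε => ?_
  obtain ⟨b, hbm, hab⟩ := exists_adjoin_norm_sub_lt ha
    (show 0 < ε / (2 * (‖u‖ + 1)) by positivity)
  have h1 : ∀ x (v : μ.L2 x), ‖a.component x v - b.component x v‖ ≤
      ε / (2 * (‖u‖ + 1)) * ‖v‖ := fun x v =>
    ((a - b).component x).le_of_opNorm_le (((a - b).norm_component_le x).trans hab.le) v
  have h2 := h1 _ u
  have h3 := h1 _ (translation μ ω ξ u)
  rw [← (translation μ ω ξ).norm_map, map_sub, hb b hbm] at h2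
  rw [(translation μ ω ξ).norm_map] at h3
  have h4 : ε / (2 * (‖u‖ + 1)) * ‖u‖ ≤ ε / 2 := by
    rw [div_mul_eq_mul_div, div_le_div_iff₀ (by positivity) two_pos]
    nlinarith [norm_nonneg u]
  rw [← dist_eq_norm] at h2 h3
  linarith [dist_triangle_right (translation μ ω ξ (a.component (G.d ξ) u))
    (a.component (G.r ξ) (translation μ ω ξ u)) (b.component (G.r ξ) (translation μ ω ξ u))]

theorem norm_component_d_le {μ : G.HaarSystem} {ω : G.TwoCocycle} {a : μ.BoundedField}
    (ha : a ∈ reducedAlgebra μ ω) (ξ : Ξ) :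
    ‖a.component (G.d ξ)‖ ≤ ‖a.component (G.r ξ)‖ := by
  refine ContinuousLinearMap.opNorm_le_bound _ (norm_nonneg _) fun u => ?_
  rw [← (translation μ ω ξ).norm_map, translation_component ha]
  exact (ContinuousLinearMap.le_opNorm _ _).trans_eq (by rw [(translation μ ω ξ).norm_map])

/-- Applied to `ξ⁻¹`, `norm_component_d_le` gives the reverse bound, so norms are constant on
orbits. -/
theorem norm_component_le_of_mem_orbit {μ : G.HaarSystem} {ω : G.TwoCocycle} {a : μ.BoundedField}
    (ha : a ∈ reducedAlgebra μ ω) {y z : X} (hz : z ∈ G.orbit y) :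
    ‖a.component z‖ ≤ ‖a.component y‖ := by
  obtain ⟨ξ, rfl, rfl⟩ := hz
  have h := norm_component_d_le ha (G.inv ξ)
  rwa [G.d_inv, G.r_inv] at h

/-! ### Lower semicontinuity of the norm -/

/-- The algebra generated by the `Π(f)` preserves the sections given by `C_c(Ξ)`. -/
theorem exists_component_restrictL2 {μ : G.HaarSystem} {ω : G.TwoCocycle} {b : μ.BoundedField}
    (hb : b ∈ NonUnitalStarAlgebra.adjoin ℂ (Set.range (regularField μ ω))) (φ : C_c(Ξ, ℂ)) :
    ∃ ψ : C_c(Ξ, ℂ), ∀ x, b.component x (restrictL2 μ φ x) = restrictL2 μ ψ x := by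
  refine adjoin_regularField_induction (p := fun b : μ.BoundedField => ∀ φ : C_c(Ξ, ℂ),
    ∃ ψ : C_c(Ξ, ℂ), ∀ x, b.component x (restrictL2 μ φ x) = restrictL2 μ ψ x)
    (fun f φ => ⟨conv μ ω f φ, fun x => regularRep_restrictL2 μ ω f φ x⟩)
    (fun φ => ⟨0, fun x => ?_⟩) (fun b c hb hc φ => ?_) (fun b c hb hc φ => ?_)
    (fun z b hb φ => ?_) hb φ
  · exact (MemLp.toLp_zero (memLp_fiber μ 0 x)).symm
  · obtain ⟨ψ, hψ⟩ := hb φ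
    obtain ⟨χ, hχ⟩ := hc φ
    exact ⟨ψ + χ, fun x => congrArg₂ (· + ·) (hψ x) (hχ x)⟩
  · obtain ⟨χ, hχ⟩ := hc φ
    obtain ⟨ψ, hψ⟩ := hb χ
    exact ⟨ψ, fun x => (congrArg (b.component x) (hχ x)).trans (hψ x)⟩
  · obtain ⟨ψ, hψ⟩ := hb φ
    exact ⟨z • ψ, fun x => congrArg (z • ·) (hψ x)⟩

/-- If the orbit of `y` accumulates at `x`, then `Π_x` is dominated by `Π_y`. -/
theorem norm_component_le_of_mem_orbitClosure {μ : G.HaarSystem} {ω : G.TwoCocycle}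
    {a : μ.BoundedField} (ha : a ∈ reducedAlgebra μ ω) {x y : X} (hx : x ∈ G.orbitClosure y) :
    ‖a.component x‖ ≤ ‖a.component y‖ := by
  refine le_of_forall_pos_le_add fun ε hε => ?_
  obtain ⟨b, hb, hab⟩ := exists_adjoin_norm_sub_lt ha (half_pos hε)
  have hsub : ∀ z, ‖a.component z - b.component z‖ ≤ ε / 2 := fun z =>
    ((a - b).norm_component_le z).trans hab.le
  have hbx : ‖b.component x‖ ≤ ‖a.component y‖ + ε / 2 := by
    refine ContinuousLinearMap.opNorm_le_bound _ (by positivity) fun u => ?_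
    refine (denseRange_restrictL2 μ x).induction_on
      (p := fun u => ‖b.component x u‖ ≤ (‖a.component y‖ + ε / 2) * ‖u‖) u
      (isClosed_le (b.component x).continuous.norm (continuous_const.mul continuous_norm))
      fun φ => ?_
    -- for sections from `C_c(Ξ)` both sides are continuous in the unit
    obtain ⟨ψ, hψ⟩ := exists_component_restrictL2 hb φ
    have hcl : IsClosed {z | ‖b.component z (restrictL2 μ φ z)‖ ≤
        (‖a.component y‖ + ε / 2) * ‖restrictL2 μ φ z‖} := by
      simp only [hψ]
      exact isClosed_le (continuous_norm_restrictL2 μ ψ)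
        (continuous_const.mul (continuous_norm_restrictL2 μ φ))
    refine closure_minimal (fun z hz => ?_) hcl hx
    refine (b.component z).le_of_opNorm_le ?_ _
    have h1 := norm_component_le_of_mem_orbit ha hz
    have h2 := norm_le_norm_add_norm_sub (a.component z) (b.component z)
    linarith [hsub z]
  have h3 := norm_le_norm_add_norm_sub' (a.component x) (b.component x)
  linarith [hsub x]

/-! ### Nondegeneracy of the regular representations -/

/-- If `Π_x(f) w = 0` for all `f`, then the continuous function `f* ⋆_ω w` vanishes at the unit,
where its value is the inner product of `f` with `w`. -/
theorem isNondegenerate_reducedRep (μ : G.HaarSystem) (ω : G.TwoCocycle) (x : X) :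
    IsNondegenerate (reducedRep μ ω x) := by
  intro w hw
  have hf : ∀ f, regularRep μ ω f x w = 0 := fun f =>
    hw ⟨regularField μ ω f, NonUnitalStarSubalgebra.le_topologicalClosure _
      (NonUnitalStarAlgebra.subset_adjoin ℂ _ ⟨f, rfl⟩)⟩
  have hinner : ∀ f, inner ℂ (restrictL2 μ f x) w = 0 := fun f => by
    set e : G.Fiber x := ⟨G.unit x, G.d_unit x⟩ with he
    have h0 : twistedConv μ ω (involution ω f) w =ᵐ[μ.measure x] 0 := by
      have h := regularRep_apply μ ω (involution ω f) x w
      rw [hf] at h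
      exact h.symm.trans (Lp.coeFn_zero _ _ _)
    have h1 : twistedConv μ ω (involution ω f) w e = 0 := by
      by_contra hne
      have h2 := (continuousAt_twistedConv_unit μ ω (involution ω f) x w).eventually_ne hne
      have h3 := MeasureTheory.Measure.measure_pos_of_mem_nhds (μ.measure x) h2
      exact h3.ne' (ae_iff.1 h0)
    rw [← h1, twistedConv, L2.inner_def]
    refine integral_congr_ae ?_
    filter_upwards [coeFn_restrictL2 μ f x] with η hη
    have h4 : kernel ω f x (η, e) = f η.1 := by
      have h5 : ω.toFun ⟨(G.divFiber η e, e.1), G.d_divFiber η e⟩ = 1 := by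
        rw [ω.congr (G.divFiber_unit x η) (b' := G.unit (G.d η.1)) (by rw [η.2])]
        exact ω.unit_right _
      rw [kernel_mk, h5, Circle.coe_one, mul_one, G.divFiber_unit]
    rw [hη, RCLike.inner_apply, kernel_involution, h4, mul_comm]
  have h6 : inner ℂ w w = 0 := (denseRange_restrictL2 μ x).induction_on
    (p := fun u => inner ℂ u w = 0) w (isClosed_eq (continuous_id.inner continuous_const)
      continuous_const) hinner
  exact inner_self_eq_zero.1 h6

end TopGroupoid

/-! ### Spectral sets of the operators `H_x` -/

theorem theorem3p3 {Ξ : Type u} {X : Type v} [TopologicalSpace Ξ] [TopologicalSpace X]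
    [T2Space Ξ] [LocallyCompactSpace Ξ] [SigmaCompactSpace Ξ] [MeasurableSpace Ξ] [BorelSpace Ξ]
    (G : TopGroupoid Ξ X) (μ : G.HaarSystem) (ω : G.TwoCocycle)
    (F : 𝓜(ℂ, TopGroupoid.reducedAlgebra μ ω)) (x y : X) :
    (G.orbitClosure x ⊆ G.orbitClosure y →
      ∀ S : CStarSpectralSet.{u},
        S.toFun (μ.L2 x →L[ℂ] μ.L2 x) (TopGroupoid.fiberOperator μ ω F x) ⊆
          S.toFun (μ.L2 y →L[ℂ] μ.L2 y) (TopGroupoid.fiberOperator μ ω F y)) ∧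
    (G.orbitClosure x = G.orbitClosure y →
      (∀ S : CStarSpectralSet.{u},
        S.toFun (μ.L2 x →L[ℂ] μ.L2 x) (TopGroupoid.fiberOperator μ ω F x) =
          S.toFun (μ.L2 y →L[ℂ] μ.L2 y) (TopGroupoid.fiberOperator μ ω F y)) ∧
      spectrum ℂ (TopGroupoid.fiberOperator μ ω F x) =
        spectrum ℂ (TopGroupoid.fiberOperator μ ω F y) ∧
      (∀ ε : ℝ, 0 < ε → pseudospectrum ε (TopGroupoid.fiberOperator μ ω F x) =
        pseudospectrum ε (TopGroupoid.fiberOperator μ ω F y)) ∧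
      numericalRange (TopGroupoid.fiberOperator μ ω F x) =
        numericalRange (TopGroupoid.fiberOperator μ ω F y) ∧
      ∀ p : Polynomial ℂ, polynomialHull p (TopGroupoid.fiberOperator μ ω F x) =
        polynomialHull p (TopGroupoid.fiberOperator μ ω F y)) := by
  have hle : ∀ {x y : X}, G.orbitClosure x ⊆ G.orbitClosure y → ∀ a,
      ‖TopGroupoid.reducedRep μ ω x a‖ ≤ ‖TopGroupoid.reducedRep μ ω y a‖ := fun h a =>
    TopGroupoid.norm_component_le_of_mem_orbitClosure a.2 (h (G.mem_orbitClosure_self _))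
  obtain ⟨E, _, p, q, h, hp, hq, hpi, hqi⟩ := exists_common_lift
    (TopGroupoid.isNondegenerate_reducedRep μ ω y) (TopGroupoid.isNondegenerate_reducedRep μ ω x) F
  change p h = TopGroupoid.fiberOperator μ ω F y at hp
  change q h = TopGroupoid.fiberOperator μ ω F x at hq
  rw [← hp, ← hq]
  refine ⟨fun hxy S => ?_, fun hxy => ?_⟩
  · rw [S.map_eq _ _ p (hpi (hle hxy)) h]
    exact S.map_subset _ _ q h
  · have hp' := hpi (hle hxy.subset)
    have hq' := hqi (hle hxy.superset)
    refine ⟨fun S => ?_, ?_, fun ε _ => ?_, ?_, fun P => ?_⟩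
    · rw [S.map_eq _ _ p hp', S.map_eq _ _ q hq']
    · rw [spectrum_map_of_injective p hp', spectrum_map_of_injective q hq']
    · rw [pseudospectrum_map_of_injective p hp', pseudospectrum_map_of_injective q hq']
    · rw [numericalRange_map_of_injective p hp', numericalRange_map_of_injective q hq']
    · rw [polynomialHull_map_of_injective p hp', polynomialHull_map_of_injective q hq']
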